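/- For $s\ge 1$ put $a(s)=-1+\frac{1}{s^2(s+1)}$ and $b(s)=-s-\frac{1}{s^2(s+1)}$, and consider the real polynomial map $$F_s:\mathbb R\to\mathbb R,\qquad F_s(x)=a(s)x^3+b(s)x^2+1 .$$ For a map $f:\mathbb R\to\mathbb R$ such that each iterate $f^n$, $n\ge 1$, has finitely many fixed points, let $N_n(f)$ be the number of isolated fixed points of $f^n$, and let the Artin--Mazur zeta function of $f$ be the formal power series $\zeta_f(t)=\exp\left(\sum_{n\ge1}\frac{1}{n}N_n(f)t^n\right)$. A real polynomial all of whose critical points are real is called post-critically finite (PCF) if the union of the forward orbits of its critical points is finite, and hyperbolic if each of its critical points either is asymptotic to an attracting periodic cycle (a cycle whose multiplier has absolute value $<1$) or escapes to infinity. There exists $s_*>1$ such that for every $s\in[1,s_*]$ the polynomial $F_s$ has degree $3$, its two critical points are real and distinct, every iterate $F_s^n$ with $n\ge1$ has finitely many fixed points in $\mathbb R$, and $$\zeta_{F_s}(t)=\frac{1}{(1-t^3)(1-t^2)(1-t-t^2)} .$$ Moreover, there are uncountably many $s\in[1,s_*]$ for which $F_s$ is neither PCF nor hyperbolic. -/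

import Mathlib

open Filter Topology Polynomial

/-! ### The Artin-Mazur zeta function -/

/-- `N_n(f)`: the number of isolated fixed points of the `n`-th iterate of `f`. -/
noncomputable def numIsolatedFixedPts {X : Type*} [TopologicalSpace X] (f : X → X) (n : ℕ) : ℕ :=
  {x : X | f^[n] x = x ∧ ∀ᶠ y in 𝓝[≠] x, f^[n] y ≠ y}.ncard

/-- The formal power series `∑_{n ≥ 1} (N_n(f) / n) t^n`. -/
noncomputable def zetaExponent {X : Type*} [TopologicalSpace X] (f : X → X) : PowerSeries ℚ :=
  PowerSeries.mk fun n => if n = 0 then 0 else (numIsolatedFixedPts f n : ℚ) / (n : ℚ)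

/-- The exponent has zero constant term, so it may be substituted in the exponential series. -/
theorem zetaExponent_hasSubst {X : Type*} [TopologicalSpace X] (f : X → X) :
    PowerSeries.HasSubst (zetaExponent f) :=
  PowerSeries.HasSubst.of_constantCoeff_zero' (by
    rw [← PowerSeries.coeff_zero_eq_constantCoeff_apply]
    simp [zetaExponent])

/-- The Artin-Mazur zeta function `ζ_f(t) = exp (∑_{n ≥ 1} (N_n(f) / n) t^n)`,
a formal power series in `t`. -/
noncomputable def artinMazurZeta {X : Type*} [TopologicalSpace X] (f : X → X) : PowerSeries ℚ :=
  PowerSeries.subst (zetaExponent f) (PowerSeries.exp ℚ)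

/-! ### Post-critically finite and hyperbolic real polynomials -/

/-- The real critical points of a real polynomial. -/
def critSet (P : ℝ[X]) : Set ℝ := {c | P.derivative.eval c = 0}

/-- The polynomial map `ℝ → ℝ` is post-critically finite (PCF):
the union of the forward orbits of its critical points is finite. -/
def IsPCF (P : ℝ[X]) : Prop :=
  (⋃ c ∈ critSet P, Set.range fun k : ℕ => (fun x => P.eval x)^[k] c).Finite

/-- `x` is an attracting periodic point of `f`, of (not necessarily minimal) period `n ≥ 1`:
`f^n(x) = x` and the multiplier `(f^n)'(x)` has absolute value `< 1`. -/
def IsAttractingPeriodicPt (f : ℝ → ℝ) (n : ℕ) (x : ℝ) : Prop :=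
  1 ≤ n ∧ f^[n] x = x ∧ |deriv f^[n] x| < 1

/-- `y` is asymptotic to the cycle of the point `x` of period `n`:
`f^{kn+m}(y) → x` as `k → ∞`, for some `m`. -/
def IsAsymptoticTo (f : ℝ → ℝ) (y : ℝ) (n : ℕ) (x : ℝ) : Prop :=
  ∃ m : ℕ, Tendsto (fun k : ℕ => f^[k * n + m] y) atTop (𝓝 x)

/-- The polynomial map `ℝ → ℝ` is hyperbolic: every critical point is asymptotic to an
attracting periodic cycle or escapes to infinity. -/
def IsHyperbolicPoly (P : ℝ[X]) : Prop :=
  ∀ c ∈ critSet P,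
    (∃ n x, IsAttractingPeriodicPt (fun y => P.eval y) n x ∧
      IsAsymptoticTo (fun y => P.eval y) c n x) ∨
    Tendsto (fun k : ℕ => |(fun y => P.eval y)^[k] c|) atTop atTop

/-! ### The family of cubics -/

/-- `a(s) = -1 + 1 / (s² (s + 1))`. -/
noncomputable def cubicA (s : ℝ) : ℝ := -1 + 1 / (s ^ 2 * (s + 1))

/-- `b(s) = -s - 1 / (s² (s + 1))`. -/
noncomputable def cubicB (s : ℝ) : ℝ := -s - 1 / (s ^ 2 * (s + 1))

/-- `F_s(x) = a(s) x³ + b(s) x² + 1`. -/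
noncomputable def cubicF (s : ℝ) : ℝ[X] := C (cubicA s) * X ^ 3 + C (cubicB s) * X ^ 2 + 1

/-!
For `s` slightly above `1` the map `F_s` has the cycle `0 ↦ 1 ↦ -s ↦ 0` through its critical
point `0`, and its other critical point is at most `-s`. On `[-s, 1]` it is therefore
unimodal with Markov partition `[-s, 0]`, `[0, 1]` and the golden mean shift as transition rule.
A cubic whose critical points are real and lie outside an interval increases cross ratios, so that
`F_s` expands the Hilbert metrics of the two pieces, and every cyclic golden mean word is the
itinerary of exactly one periodic point off the cycle of `0`. Outside `[-s, 1]` the only periodic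
points form one `2`-cycle. The three kinds of periodic points account for the three factors of the
zeta function.

A semiconjugacy from `F_s` to the tent map whose slope is the golden ratio `φ` depends continuously
on `s`, so its value at the free critical point sweeps out an interval as `s` varies. If the free
critical orbit is finite or converges to a cycle, then the semiconjugacy takes some value twice
along it, in the latter case because `F_s` locally expands differences of values. Hence the orbit of
the value at the free critical point under the tent map is eventually periodic, and this value lies
in the countable field generated by `φ`, whereas the interval is uncountable.
-/

/-! ### Zeta functions from fixed point counts -/

section ZetaFunction

open PowerSeries

/-- `N` is minus the logarithmic derivative `-P' / P` of `P`. If `P` has constant term `1`, this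
says that `1 / P` is the zeta function of a map whose `(m + 1)`-st iterate has `N_m` isolated fixed
points. -/
def IsNegLogDeriv {R : Type*} [CommRing R] (P N : R⟦X⟧) : Prop := d⁄dX R P = -(P * N)

theorem IsNegLogDeriv.mul {R : Type*} [CommRing R] {P Q M N : R⟦X⟧} (hP : IsNegLogDeriv P M)
    (hQ : IsNegLogDeriv Q N) : IsNegLogDeriv (P * Q) (M + N) := by
  unfold IsNegLogDeriv at *
  rw [Derivation.leibniz, hP, hQ, smul_eq_mul, smul_eq_mul]
  ring

theorem isNegLogDeriv_one_sub_X_pow (R : Type*) [CommRing R] {k : ℕ} (hk : 1 ≤ k) :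
    IsNegLogDeriv (1 - PowerSeries.X ^ k : R⟦X⟧)
      (PowerSeries.mk fun m => if k ∣ m + 1 then (k : R) else 0) := by
  obtain ⟨k, rfl⟩ := Nat.exists_eq_add_of_le' hk
  unfold IsNegLogDeriv
  ext n
  rw [PowerSeries.coeff_derivative, sub_mul, one_mul, neg_sub, map_sub, map_sub,
    PowerSeries.coeff_X_pow_mul', PowerSeries.coeff_mk, PowerSeries.coeff_X_pow,
    PowerSeries.coeff_one, if_neg n.succ_ne_zero]
  rcases lt_trichotomy n k with h | rfl | h
  · have hdvd : ¬ k + 1 ∣ n + 1 := fun hd => absurd (Nat.le_of_dvd n.succ_pos hd) (by omega)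
    simp [hdvd, h.ne, show ¬ k + 1 ≤ n by omega]
  · simp
  · obtain ⟨m, rfl⟩ := Nat.exists_eq_add_of_le h
    have hdvd : k + 1 ∣ k + 1 + m + 1 ↔ k + 1 ∣ m + 1 := by
      rw [add_assoc (k + 1), Nat.dvd_add_right dvd_rfl]
    simp [hdvd, show ¬ k + 1 + m = k by omega]

theorem isNegLogDeriv_one_sub_X_sub_X_sq (R : Type*) [CommRing R] :
    IsNegLogDeriv (1 - PowerSeries.X - PowerSeries.X ^ 2 : R⟦X⟧)
      (PowerSeries.mk fun m => ((Nat.fib (m + 2) + Nat.fib m : ℕ) : R)) := by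
  unfold IsNegLogDeriv
  have hder : d⁄dX R (1 - PowerSeries.X - PowerSeries.X ^ 2 : R⟦X⟧) =
      -(1 + 2 * PowerSeries.X) := by
    simp only [map_sub, PowerSeries.derivative_one, PowerSeries.derivative_X,
      PowerSeries.derivative_pow]
    push_cast
    ring
  rw [hder, neg_inj, sub_mul, sub_mul, one_mul, pow_two, mul_assoc]
  ext n
  match n with
  | 0 => simp
  | 1 =>
    norm_num [PowerSeries.coeff_succ_X_mul, two_mul, PowerSeries.coeff_one]
  | n + 2 =>
    have hfib : (Nat.fib (n + 4) + Nat.fib (n + 2) : R) =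
        (Nat.fib (n + 3) + Nat.fib (n + 1)) + (Nat.fib (n + 2) + Nat.fib n) := by
      rw [Nat.fib_add_two (n := n + 2), Nat.fib_add_two (n := n)]
      push_cast
      ring
    simp [PowerSeries.coeff_succ_X_mul, two_mul, PowerSeries.coeff_one, PowerSeries.coeff_X, hfib]

theorem derivative_artinMazurZeta {Y : Type*} [TopologicalSpace Y] (f : Y → Y) :
    d⁄dX ℚ (artinMazurZeta f) = artinMazurZeta f *
      PowerSeries.mk fun m => (numIsolatedFixedPts f (m + 1) : ℚ) := by
  rw [artinMazurZeta, PowerSeries.derivative_subst (zetaExponent_hasSubst f),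
    PowerSeries.derivative_exp]
  congr 1
  ext m
  rw [PowerSeries.coeff_derivative, zetaExponent, PowerSeries.coeff_mk, PowerSeries.coeff_mk,
    if_neg m.succ_ne_zero]
  field_simp
  push_cast
  rfl

theorem constantCoeff_artinMazurZeta {Y : Type*} [TopologicalSpace Y] (f : Y → Y) :
    PowerSeries.constantCoeff (artinMazurZeta f) = 1 := by
  have h0 : PowerSeries.constantCoeff (zetaExponent f) = 0 := by
    simp [← PowerSeries.coeff_zero_eq_constantCoeff_apply, zetaExponent]
  rw [artinMazurZeta]
  refine (PowerSeries.constantCoeff_subst (zetaExponent_hasSubst f) _).trans ?_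
  rw [finsum_eq_single _ 0]
  · simp
  · intro n hn
    rw [map_pow]
    exact (congrArg _ (congrArg (· ^ n) h0)).trans (by simp [hn])

theorem artinMazurZeta_eq_inv {Y : Type*} [TopologicalSpace Y] {f : Y → Y} {P : ℚ⟦X⟧}
    (hP : PowerSeries.constantCoeff P = 1)
    (h : IsNegLogDeriv P (PowerSeries.mk fun m => (numIsolatedFixedPts f (m + 1) : ℚ))) :
    artinMazurZeta f = P⁻¹ := by
  rw [PowerSeries.eq_inv_iff_mul_eq_one (by simp [hP])]
  apply PowerSeries.derivative.ext
  · rw [Derivation.leibniz, h, derivative_artinMazurZeta, PowerSeries.derivative_one, smul_eq_mul,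
      smul_eq_mul]
    ring
  · simp [constantCoeff_artinMazurZeta, hP]

theorem artinMazurZeta_eq_of_golden_count {Y : Type*} [TopologicalSpace Y] {f : Y → Y}
    (h : ∀ m, numIsolatedFixedPts f (m + 1) =
      (if 3 ∣ m + 1 then 3 else 0) + (if 2 ∣ m + 1 then 2 else 0) +
        (Nat.fib (m + 2) + Nat.fib m)) :
    artinMazurZeta f = ((1 - PowerSeries.X ^ 3) * (1 - PowerSeries.X ^ 2) *
      (1 - PowerSeries.X - PowerSeries.X ^ 2))⁻¹ := by
  refine artinMazurZeta_eq_inv (by simp) ?_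
  convert ((isNegLogDeriv_one_sub_X_pow ℚ (k := 3) (by norm_num)).mul
    (isNegLogDeriv_one_sub_X_pow ℚ (k := 2) (by norm_num))).mul
      (isNegLogDeriv_one_sub_X_sub_X_sq ℚ) using 1
  ext m
  simp [h]

end ZetaFunction

/-! ### Words of the golden mean shift -/

/-- The words with `n + 1` letters, first letter `i` and last letter `j`, of the golden mean shift,
in which the letter `false` may only be followed by `true`. -/
def goldenWords : ℕ → Bool → Bool → Finset (List Bool)
  | 0, i, j => if i = j then {[i]} else ∅
  | n + 1, false, j => (goldenWords n true j).image (List.cons false)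
  | n + 1, true, j => (goldenWords n false j ∪ goldenWords n true j).image (List.cons true)

namespace goldenWords

theorem head?_eq {n : ℕ} {i j : Bool} {l : List Bool} (h : l ∈ goldenWords n i j) :
    l.head? = some i := by
  cases n with
  | zero => grind [goldenWords]
  | succ n => cases i <;> grind [goldenWords]

theorem mem_succ {n : ℕ} {i j : Bool} {l : List Bool} :
    l ∈ goldenWords (n + 1) i j ↔
      ∃ k, (i = true ∨ k = true) ∧ ∃ l' ∈ goldenWords n k j, i :: l' = l := by
  cases i <;> simp [goldenWords, or_and_right, exists_or]

theorem disjoint (m n : ℕ) (j k : Bool) :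
    Disjoint (goldenWords m false j) (goldenWords n true k) :=
  Finset.disjoint_left.2 fun _ hl hl' => by simpa [head?_eq hl] using head?_eq hl'

theorem card_succ_false (n : ℕ) (j : Bool) :
    (goldenWords (n + 1) false j).card = (goldenWords n true j).card :=
  Finset.card_image_of_injective _ List.cons_injective

theorem card_succ_true (n : ℕ) (j : Bool) :
    (goldenWords (n + 1) true j).card =
      (goldenWords n false j).card + (goldenWords n true j).card := by
  rw [goldenWords, Finset.card_image_of_injective _ List.cons_injective,
    Finset.card_union_of_disjoint (disjoint n n j j)]

theorem card_true (n : ℕ) :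
    (goldenWords n false true).card = Nat.fib n ∧
      (goldenWords n true true).card = Nat.fib (n + 1) := by
  induction n with
  | zero => simp [goldenWords]
  | succ n ih => simp [card_succ_false, card_succ_true, ih.1, ih.2, Nat.fib_add_two]

theorem card_false (n : ℕ) :
    (goldenWords (n + 1) false false).card = Nat.fib n ∧
      (goldenWords (n + 1) true false).card = Nat.fib (n + 1) := by
  induction n with
  | zero => simp [goldenWords]
  | succ n ih =>
    simp [card_succ_false, card_succ_true (n + 1), ih.1, ih.2, Nat.fib_add_two]

/-- The words whose first and last letters agree, which code the points of period `n` of a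
golden mean Markov map. -/
def cyclic (n : ℕ) : Finset (List Bool) := goldenWords n false false ∪ goldenWords n true true

theorem card_cyclic (m : ℕ) : (cyclic (m + 1)).card = Nat.fib (m + 2) + Nat.fib m := by
  rw [cyclic, Finset.card_union_of_disjoint (disjoint _ _ _ _), (card_false m).1,
    (card_true (m + 1)).2, add_comm]

end goldenWords

/-! ### Periodic points -/

theorem isPeriodicPt_iff_dvd_of_prime {X : Type*} {f : X → X} {p : ℕ} [Fact p.Prime] {x : X}
    (hx : Function.IsPeriodicPt f p x) (hfix : ¬ Function.IsFixedPt f x) (n : ℕ) :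
    Function.IsPeriodicPt f n x ↔ p ∣ n := by
  rw [Function.isPeriodicPt_iff_minimalPeriod_dvd, Function.minimalPeriod_eq_prime hx hfix]

theorem iterate_notMem_of_isPeriodicPt {X : Type*} {f : X → X} {S : Set X} {n : ℕ} {x : X}
    (hS : Set.MapsTo f S S) (hn : n ≠ 0) (hx : Function.IsPeriodicPt f n x) (hxS : x ∉ S) (k : ℕ) :
    f^[k] x ∉ S := by
  intro hk
  have hkn : k ≤ n * k := Nat.le_mul_of_pos_left k (Nat.pos_of_ne_zero hn)
  have hback := hS.iterate (n * k - k) hk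
  rw [← Function.iterate_add_apply, Nat.sub_add_cancel hkn, (hx.mul_const k).eq] at hback
  exact hxS hback

theorem eq_of_isPeriodicPt_of_expanding {X : Type*} {f : X → X} {d : X → X → ℝ} {n : ℕ} {x y : X}
    (hn : n ≠ 0) (hx : Function.IsPeriodicPt f n x) (hy : Function.IsPeriodicPt f n y)
    (hd : ∀ k < n, f^[k] x ≠ f^[k] y →
      d (f^[k] x) (f^[k] y) < d (f (f^[k] x)) (f (f^[k] y))) :
    x = y := by
  by_contra hxy
  have hne : ∀ k ≤ n, f^[k] x ≠ f^[k] y := fun k hk heq => hxy <| by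
    rw [← hx.eq, ← hy.eq, ← Nat.sub_add_cancel hk, Function.iterate_add_apply, heq,
      Function.iterate_add_apply]
  have hlt : ∀ k < n, d x y < d (f^[k + 1] x) (f^[k + 1] y) := by
    intro k
    induction k with
    | zero => exact fun hk => hd 0 hk hxy
    | succ k ih =>
      intro hk
      have hstep := hd (k + 1) hk (hne _ hk.le)
      rw [← Function.iterate_succ_apply' f, ← Function.iterate_succ_apply' f] at hstep
      exact (ih (by omega)).trans hstep
  have := hlt (n - 1) (by omega)
  rw [Nat.sub_add_cancel (Nat.pos_of_ne_zero hn), hx.eq, hy.eq] at this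
  exact this.false

theorem numIsolatedFixedPts_eq_ncard {X : Type*} [TopologicalSpace X] [T1Space X] {f : X → X}
    {n : ℕ} (hfin : (Function.ptsOfPeriod f n).Finite) :
    numIsolatedFixedPts f n = (Function.ptsOfPeriod f n).ncard :=
  congrArg Set.ncard (Set.ext fun x => and_iff_left_of_imp fun _ =>
    nhdsNE_le_cofinite x hfin.compl_mem_cofinite)

theorem deriv_iterate_eq_zero {f : ℝ → ℝ} (hf : Differentiable ℝ f) {k n : ℕ} (hkn : k < n) {x : ℝ}
    (hk : deriv f (f^[k] x) = 0) : deriv f^[n] x = 0 := by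
  obtain ⟨m, rfl⟩ := Nat.exists_eq_add_of_lt hkn
  rw [show k + m + 1 = m + (k + 1) by ring, Function.iterate_add, Function.iterate_succ' f k,
    deriv_comp _ (hf.iterate m _) ((hf.comp (hf.iterate k)) x),
    deriv_comp _ (hf _) (hf.iterate k x), hk]
  ring

theorem exists_isFixedPt_mem_Ioo {g : ℝ → ℝ} {a b : ℝ} (hab : a < b) (hg : Differentiable ℝ g)
    (ha : g a < a ∨ g a = a ∧ deriv g a < 1) (hb : b < g b ∨ g b = b ∧ deriv g b < 1) :
    ∃ x ∈ Set.Ioo a b, Function.IsFixedPt g x := by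
  have hsign : ∀ c, g c = c → deriv g c < 1 →
      ∀ᶠ x in 𝓝 c, SignType.sign (x - g x) = SignType.sign (x - c) := fun c hc hdc =>
    eventually_nhdsWithin_sign_eq_of_deriv_pos (f := fun x => x - g x) (by
      simpa [deriv_fun_sub differentiableAt_fun_id (hg c)] using hdc) (by simp [hc])
  have ha' : ∀ᶠ x in 𝓝[>] a, g x < x := by
    rcases ha with ha | ⟨ha, hda⟩
    · exact nhdsWithin_le_nhds (hg.continuous.continuousAt.eventually_lt continuousAt_id ha)
    · filter_upwards [nhdsWithin_le_nhds (hsign a ha hda), self_mem_nhdsWithin] with x hx hax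
      rw [sign_pos (sub_pos.2 (Set.mem_Ioi.1 hax)), sign_eq_one_iff] at hx
      linarith
  have hb' : ∀ᶠ x in 𝓝[<] b, x < g x := by
    rcases hb with hb | ⟨hb, hdb⟩
    · exact nhdsWithin_le_nhds (continuousAt_id.eventually_lt hg.continuous.continuousAt hb)
    · filter_upwards [nhdsWithin_le_nhds (hsign b hb hdb), self_mem_nhdsWithin] with x hx hxb
      rw [sign_neg (sub_neg.2 (Set.mem_Iio.1 hxb)), sign_eq_neg_one_iff] at hx
      linarith
  obtain ⟨u, hgu, hau, hum⟩ := (ha'.and (Ioo_mem_nhdsGT (left_lt_add_div_two.2 hab))).exists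
  obtain ⟨v, hgv, hmv, hvb⟩ := (hb'.and (Ioo_mem_nhdsLT (add_div_two_lt_right.2 hab))).exists
  obtain ⟨x, ⟨hux, hxv⟩, hx⟩ := isPreconnected_Icc.intermediate_value₂
    (Set.left_mem_Icc.2 (hum.trans hmv).le) (Set.right_mem_Icc.2 (hum.trans hmv).le)
    hg.continuous.continuousOn continuousOn_id hgu.le hgv.le
  exact ⟨x, ⟨hau.trans_le hux, hxv.trans_lt hvb⟩, hx⟩

/-! ### Unimodal maps with a golden mean Markov partition -/

/-- A unimodal map of `[-s, 1]` with turning point `0` on the cycle `0 ↦ 1 ↦ -s ↦ 0`. The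
pieces `[-s, 0]` and `[0, 1]` form a Markov partition: the first is mapped onto the second, and the
second onto the whole interval. -/
structure IsGoldenUnimodal (s : ℝ) (f : ℝ → ℝ) : Prop where
  pos : 0 < s
  continuous : Continuous f
  map_zero : f 0 = 1
  map_one : f 1 = -s
  map_neg : f (-s) = 0
  strictMonoOn : StrictMonoOn f (Set.Icc (-s) 0)
  strictAntiOn : StrictAntiOn f (Set.Icc 0 1)

/-- The periodic orbit of the turning point of a golden unimodal map. -/
def turningCycle (s : ℝ) : Set ℝ := {0, 1, -s}

/-- The left endpoint of a piece of the Markov partition; `true` stands for `[0, 1]` and `false`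
for `[-s, 0]`. -/
def pieceLeft (s : ℝ) (i : Bool) : ℝ := if i then 0 else -s

/-- The right endpoint of a piece of the Markov partition. -/
def pieceRight (i : Bool) : ℝ := if i then 1 else 0

/-- The points `x` and `y` lie in the interior of the same piece of the Markov partition. -/
def InSamePiece (s x y : ℝ) : Prop :=
  ∃ i, x ∈ Set.Ioo (pieceLeft s i) (pieceRight i) ∧ y ∈ Set.Ioo (pieceLeft s i) (pieceRight i)

/-- The itinerary of `x, f x, …, f^n x` with respect to the Markov partition. -/
noncomputable def signWord (f : ℝ → ℝ) (n : ℕ) (x : ℝ) : List Bool :=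
  (List.iterate f x (n + 1)).map fun y => decide (0 < y)

theorem signWord_zero (f : ℝ → ℝ) (x : ℝ) : signWord f 0 x = [decide (0 < x)] := rfl

theorem signWord_succ (f : ℝ → ℝ) (n : ℕ) (x : ℝ) :
    signWord f (n + 1) x = decide (0 < x) :: signWord f n (f x) := rfl

theorem pos_iterate_iff_of_signWord_eq {f : ℝ → ℝ} {n : ℕ} {x y : ℝ}
    (h : signWord f n x = signWord f n y) {k : ℕ} (hk : k ≤ n) :
    0 < f^[k] x ↔ 0 < f^[k] y := by
  have hget := congrArg (fun l : List Bool => l[k]?) h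
  simpa [signWord, Nat.lt_succ_of_le hk, -List.iterate] using hget

theorem exists_Icc_pullback {f : ℝ → ℝ} {a b p q : ℝ} (hf : ContinuousOn f (Set.Icc p q))
    (hinj : Set.InjOn f (Set.Icc p q)) (hab : a < b) (hsub : Set.Icc a b ⊆ f '' Set.Icc p q) :
    ∃ c d, c < d ∧ Set.Icc c d ⊆ Set.Icc p q ∧ Set.MapsTo f (Set.Ioo c d) (Set.Ioo a b) ∧
      (f c = a ∧ f d = b ∨ f c = b ∧ f d = a) := by
  obtain ⟨c, hc, rfl⟩ := hsub (Set.left_mem_Icc.2 hab.le)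
  obtain ⟨d, hd, rfl⟩ := hsub (Set.right_mem_Icc.2 hab.le)
  rcases hf.strictMonoOn_of_injOn_Icc' (hc.1.trans hc.2) hinj with hmono | hanti
  · have hsubset := Set.Icc_subset_Icc hc.1 hd.2
    refine ⟨c, d, (hmono.lt_iff_lt hc hd).1 hab, hsubset, fun x hx => ?_, .inl ⟨rfl, rfl⟩⟩
    have hxI := hsubset (Set.Ioo_subset_Icc_self hx)
    exact ⟨hmono hc hxI hx.1, hmono hxI hd hx.2⟩
  · have hsubset := Set.Icc_subset_Icc hd.1 hc.2
    refine ⟨d, c, (hanti.lt_iff_gt hc hd).1 hab, hsubset, fun x hx => ?_, .inr ⟨rfl, rfl⟩⟩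
    have hxI := hsubset (Set.Ioo_subset_Icc_self hx)
    exact ⟨hanti hxI hc hx.2, hanti hd hxI hx.1⟩

theorem decide_pos_eq_of_mem_piece {s x : ℝ} {i : Bool}
    (hx : x ∈ Set.Ioo (pieceLeft s i) (pieceRight i)) :
    decide (0 < x) = i := by
  cases i
  · simpa [pieceRight] using hx.2.le
  · simpa [pieceLeft] using hx.1

theorem mem_piece_of_mem_diff {s x : ℝ} (hx : x ∈ Set.Icc (-s) 1 \ turningCycle s) :
    x ∈ Set.Ioo (pieceLeft s (decide (0 < x))) (pieceRight (decide (0 < x))) := by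
  obtain ⟨⟨hsx, hx1⟩, hxt⟩ := hx
  simp only [turningCycle, Set.mem_insert_iff, Set.mem_singleton_iff, not_or] at hxt
  by_cases h : 0 < x
  · simpa [pieceLeft, pieceRight, h] using lt_of_le_of_ne hx1 hxt.2.1
  · simpa [pieceLeft, pieceRight, h] using
      ⟨lt_of_le_of_ne hsx (Ne.symm hxt.2.2), lt_of_le_of_ne (not_lt.1 h) hxt.1⟩

namespace IsGoldenUnimodal

variable {s : ℝ} {f : ℝ → ℝ}

theorem pieceLeft_lt_pieceRight (hf : IsGoldenUnimodal s f) (i : Bool) :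
    pieceLeft s i < pieceRight i := by
  cases i <;> simp [pieceLeft, pieceRight, hf.pos]

theorem mapsTo_turningCycle (hf : IsGoldenUnimodal s f) :
    Set.MapsTo f (turningCycle s) (turningCycle s) := by
  rintro x (rfl | rfl | rfl) <;> simp [turningCycle, hf.map_zero, hf.map_one, hf.map_neg]

theorem mapsTo_Icc (hf : IsGoldenUnimodal s f) :
    Set.MapsTo f (Set.Icc (-s) 1) (Set.Icc (-s) 1) := by
  have hs := hf.pos
  rintro x ⟨hsx, hx1⟩
  rcases le_total x 0 with h0 | h0
  · have hlow := hf.strictMonoOn.monotoneOn ⟨le_rfl, by linarith⟩ ⟨hsx, h0⟩ hsx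
    have hupp := hf.strictMonoOn.monotoneOn ⟨hsx, h0⟩ ⟨by linarith, le_rfl⟩ h0
    rw [hf.map_neg] at hlow
    exact ⟨by linarith, hupp.trans_eq hf.map_zero⟩
  · have hupp := hf.strictAntiOn.antitoneOn ⟨le_rfl, zero_le_one⟩ ⟨h0, hx1⟩ h0
    have hlow := hf.strictAntiOn.antitoneOn ⟨h0, hx1⟩ ⟨zero_le_one, le_rfl⟩ hx1
    exact ⟨hf.map_one.symm.trans_le hlow, hupp.trans_eq hf.map_zero⟩

theorem isPeriodicPt_three (hf : IsGoldenUnimodal s f) {x : ℝ} (hx : x ∈ turningCycle s) :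
    Function.IsPeriodicPt f 3 x := by
  rcases hx with rfl | rfl | rfl <;>
    simp [Function.IsPeriodicPt, Function.IsFixedPt, hf.map_zero, hf.map_one, hf.map_neg]

theorem not_isFixedPt (hf : IsGoldenUnimodal s f) {x : ℝ} (hx : x ∈ turningCycle s) :
    ¬ Function.IsFixedPt f x := by
  have hs := hf.pos
  rcases hx with rfl | rfl | rfl <;> unfold Function.IsFixedPt
  · rw [hf.map_zero]; exact one_ne_zero
  · rw [hf.map_one]; linarith
  · rw [hf.map_neg]; linarith

theorem isPeriodicPt_iff_three_dvd (hf : IsGoldenUnimodal s f) {x : ℝ} (hx : x ∈ turningCycle s)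
    (n : ℕ) : Function.IsPeriodicPt f n x ↔ 3 ∣ n :=
  isPeriodicPt_iff_dvd_of_prime (hf.isPeriodicPt_three hx) (hf.not_isFixedPt hx) n

theorem deriv_iterate_turningCycle (hf : IsGoldenUnimodal s f) (hdiff : Differentiable ℝ f)
    (hcrit : deriv f 0 = 0) {n : ℕ} (hn : n ≠ 0) {x : ℝ} (hx : x ∈ turningCycle s)
    (hper : Function.IsPeriodicPt f n x) : deriv f^[n] x = 0 := by
  have h3n : 3 ≤ n :=
    Nat.le_of_dvd (Nat.pos_of_ne_zero hn) ((hf.isPeriodicPt_iff_three_dvd hx n).1 hper)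
  rcases hx with rfl | rfl | rfl
  · exact deriv_iterate_eq_zero hdiff (k := 0) (by omega) hcrit
  · refine deriv_iterate_eq_zero hdiff (k := 2) (by omega) ?_
    simpa [hf.map_one, hf.map_neg] using hcrit
  · refine deriv_iterate_eq_zero hdiff (k := 1) (by omega) ?_
    simpa [hf.map_neg] using hcrit

theorem Icc_subset_image (hf : IsGoldenUnimodal s f) {i k : Bool} (hik : i = true ∨ k = true) :
    Set.Icc (pieceLeft s k) (pieceRight k) ⊆ f '' Set.Icc (pieceLeft s i) (pieceRight i) := by
  have hs := hf.pos
  cases i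
  · obtain rfl : k = true := by simpa using hik
    simpa [pieceLeft, pieceRight, hf.map_zero, hf.map_neg] using
      intermediate_value_Icc (neg_nonpos.2 hs.le) hf.continuous.continuousOn
  · have himage := intermediate_value_Icc' zero_le_one hf.continuous.continuousOn
    rw [hf.map_zero, hf.map_one] at himage
    refine Set.Subset.trans (Set.Icc_subset_Icc ?_ ?_) himage <;>
      cases k <;> simp [pieceLeft, pieceRight, hs.le]

theorem injOn_piece (hf : IsGoldenUnimodal s f) (i : Bool) :
    Set.InjOn f (Set.Icc (pieceLeft s i) (pieceRight i)) := by
  cases i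
  · exact hf.strictMonoOn.injOn
  · exact hf.strictAntiOn.injOn

theorem exists_cylinder (hf : IsGoldenUnimodal s f) {n : ℕ} {i j : Bool} {l : List Bool}
    (hl : l ∈ goldenWords n i j) :
    ∃ a b, a < b ∧ Set.Icc a b ⊆ Set.Icc (pieceLeft s i) (pieceRight i) ∧
      (∀ x ∈ Set.Ioo a b, signWord f n x = l) ∧
      (f^[n] a = pieceLeft s j ∧ f^[n] b = pieceRight j ∨
        f^[n] a = pieceRight j ∧ f^[n] b = pieceLeft s j) := by
  induction n generalizing i l with
  | zero =>
    obtain ⟨rfl, rfl⟩ : i = j ∧ l = [i] := by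
      by_cases hij : i = j <;> simp_all [goldenWords]
    exact ⟨_, _, hf.pieceLeft_lt_pieceRight i, subset_rfl,
      fun x hx => by rw [signWord_zero, decide_pos_eq_of_mem_piece hx], .inl ⟨rfl, rfl⟩⟩
  | succ n ih =>
    obtain ⟨k, hik, l, hl', rfl⟩ := goldenWords.mem_succ.1 hl
    obtain ⟨a, b, hab, hsub, hword, hends⟩ := ih hl'
    obtain ⟨c, d, hcd, hsub', hmaps, hends'⟩ := exists_Icc_pullback hf.continuous.continuousOn
      (hf.injOn_piece i) hab (hsub.trans (hf.Icc_subset_image hik))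
    refine ⟨c, d, hcd, hsub', fun x hx => ?_, ?_⟩
    · have hxi := Set.Ioo_subset_Ioo (hsub' (Set.left_mem_Icc.2 hcd.le)).1
        (hsub' (Set.right_mem_Icc.2 hcd.le)).2 hx
      rw [signWord_succ, decide_pos_eq_of_mem_piece hxi, hword _ (hmaps hx)]
    · simp only [Function.iterate_succ_apply]
      rcases hends' with ⟨hc, hd⟩ | ⟨hc, hd⟩ <;> rw [hc, hd]
      · exact hends
      · exact hends.symm.imp And.symm And.symm

theorem exists_isFixedPt_of_endpoints (hf : IsGoldenUnimodal s f) (hdiff : Differentiable ℝ f)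
    (hcrit : deriv f 0 = 0) {n : ℕ} (hn : n ≠ 0) {i : Bool} {a b : ℝ} (hab : a < b)
    (hsub : Set.Icc a b ⊆ Set.Icc (pieceLeft s i) (pieceRight i))
    (hends : f^[n] a = pieceLeft s i ∧ f^[n] b = pieceRight i ∨
      f^[n] a = pieceRight i ∧ f^[n] b = pieceLeft s i) :
    ∃ x ∈ Set.Ioo a b, Function.IsPeriodicPt f n x := by
  have ha := hsub (Set.left_mem_Icc.2 hab.le)
  have hb := hsub (Set.right_mem_Icc.2 hab.le)
  have hderiv : ∀ x ∈ turningCycle s, f^[n] x = x → deriv f^[n] x < 1 := fun x hx hper =>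
    (hf.deriv_iterate_turningCycle hdiff hcrit hn hx hper).trans_lt one_pos
  rcases hends with ⟨hfa, hfb⟩ | ⟨hfa, hfb⟩
  · refine exists_isFixedPt_mem_Ioo hab (hdiff.iterate n) ?_ ?_
    · refine (hfa.trans_le ha.1).lt_or_eq.imp_right fun h => ⟨h, hderiv a ?_ h⟩
      rw [← h, hfa]
      cases i <;> simp [turningCycle, pieceLeft]
    · refine (hb.2.trans_eq hfb.symm).lt_or_eq.imp_right fun h => ⟨h.symm, hderiv b ?_ h.symm⟩
      rw [h, hfb]
      cases i <;> simp [turningCycle, pieceRight]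
  · obtain ⟨x, hx, hfix⟩ := intermediate_value_Ioo' (f := fun x => f^[n] x - x) hab.le
      ((hf.continuous.iterate n).sub continuous_id).continuousOn
      (show (0 : ℝ) ∈ Set.Ioo (f^[n] b - b) (f^[n] a - a) from
        ⟨by linarith [ha.1], by linarith [hb.2]⟩)
    exact ⟨x, hx, sub_eq_zero.1 hfix⟩

theorem mem_diff_of_mem_piece (hf : IsGoldenUnimodal s f) {i : Bool} {x : ℝ}
    (hx : x ∈ Set.Ioo (pieceLeft s i) (pieceRight i)) :
    x ∈ Set.Icc (-s) 1 \ turningCycle s := by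
  have hs := hf.pos
  obtain ⟨hl, hr⟩ := hx
  cases i <;> simp only [pieceLeft, pieceRight, Bool.false_eq_true, if_false, if_true] at hl hr <;>
    refine ⟨⟨by linarith, by linarith⟩, ?_⟩ <;>
    simp only [turningCycle, Set.mem_insert_iff, Set.mem_singleton_iff] <;>
    rintro (h | h | h) <;> linarith

theorem iterate_mem_diff (hf : IsGoldenUnimodal s f) {n : ℕ} (hn : n ≠ 0) {x : ℝ}
    (hx : x ∈ Set.Icc (-s) 1 \ turningCycle s) (hper : Function.IsPeriodicPt f n x) (k : ℕ) :
    f^[k] x ∈ Set.Icc (-s) 1 \ turningCycle s :=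
  ⟨hf.mapsTo_Icc.iterate k hx.1,
    iterate_notMem_of_isPeriodicPt hf.mapsTo_turningCycle hn hper hx.2 k⟩

theorem pos_or_pos_map (hf : IsGoldenUnimodal s f) {x : ℝ}
    (hx : x ∈ Set.Icc (-s) 1 \ turningCycle s) : 0 < x ∨ 0 < f x := by
  refine or_iff_not_imp_left.2 fun h => ?_
  have hs := hf.pos
  have hxs : -s < x := hx.1.1.lt_of_ne fun h' => hx.2 (by simp [turningCycle, h'])
  exact hf.map_neg.symm.trans_lt
    (hf.strictMonoOn ⟨le_rfl, by linarith⟩ ⟨hx.1.1, not_lt.1 h⟩ hxs)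

theorem signWord_mem_goldenWords (hf : IsGoldenUnimodal s f) (n : ℕ) {x : ℝ}
    (hx : ∀ k < n, f^[k] x ∈ Set.Icc (-s) 1 \ turningCycle s) :
    signWord f n x ∈ goldenWords n (decide (0 < x)) (decide (0 < f^[n] x)) := by
  induction n generalizing x with
  | zero =>
    rw [signWord_zero, goldenWords, Function.iterate_zero_apply, if_pos rfl, Finset.mem_singleton]
  | succ n ih =>
    refine goldenWords.mem_succ.2 ⟨decide (0 < f x), ?_, signWord f n (f x), ?_, rfl⟩
    · simpa using hf.pos_or_pos_map (hx 0 n.succ_pos)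
    · exact ih fun k hk => hx (k + 1) (by omega)

theorem signWord_mem_cyclic (hf : IsGoldenUnimodal s f) {n : ℕ} (hn : n ≠ 0) {x : ℝ}
    (hx : x ∈ Set.Icc (-s) 1 \ turningCycle s) (hper : Function.IsPeriodicPt f n x) :
    signWord f n x ∈ goldenWords.cyclic n := by
  have hmem := hf.signWord_mem_goldenWords n fun k _ => hf.iterate_mem_diff hn hx hper k
  rw [hper.eq] at hmem
  rw [goldenWords.cyclic, Finset.mem_union]
  cases h : decide (0 < x) <;> rw [h] at hmem
  · exact .inl hmem
  · exact .inr hmem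

theorem exists_isPeriodicPt_signWord_eq (hf : IsGoldenUnimodal s f) (hdiff : Differentiable ℝ f)
    (hcrit : deriv f 0 = 0) {n : ℕ} (hn : n ≠ 0) {l : List Bool} (hl : l ∈ goldenWords.cyclic n) :
    ∃ x ∈ Set.Icc (-s) 1 \ turningCycle s, Function.IsPeriodicPt f n x ∧ signWord f n x = l := by
  obtain ⟨i, hl⟩ : ∃ i, l ∈ goldenWords n i i :=
    (Finset.mem_union.1 hl).elim (fun h => ⟨_, h⟩) (fun h => ⟨_, h⟩)
  obtain ⟨a, b, hab, hsub, hword, hends⟩ := hf.exists_cylinder hl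
  obtain ⟨x, hx, hper⟩ := hf.exists_isFixedPt_of_endpoints hdiff hcrit hn hab hsub hends
  refine ⟨x, hf.mem_diff_of_mem_piece (i := i) ?_, hper, hword x hx⟩
  exact Set.Ioo_subset_Ioo (hsub (Set.left_mem_Icc.2 hab.le)).1
    (hsub (Set.right_mem_Icc.2 hab.le)).2 hx

theorem eq_of_signWord_eq (hf : IsGoldenUnimodal s f) {d : ℝ → ℝ → ℝ}
    (hd : ∀ x y, InSamePiece s x y → InSamePiece s (f x) (f y) → x ≠ y → d x y < d (f x) (f y))
    {n : ℕ} (hn : n ≠ 0) {x y : ℝ} (hx : x ∈ Set.Icc (-s) 1 \ turningCycle s)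
    (hy : y ∈ Set.Icc (-s) 1 \ turningCycle s) (hpx : Function.IsPeriodicPt f n x)
    (hpy : Function.IsPeriodicPt f n y) (hxy : signWord f n x = signWord f n y) : x = y := by
  have hsame : ∀ k ≤ n, InSamePiece s (f^[k] x) (f^[k] y) := fun k hk => by
    refine ⟨_, mem_piece_of_mem_diff (hf.iterate_mem_diff hn hx hpx k), ?_⟩
    rw [decide_eq_decide.2 (pos_iterate_iff_of_signWord_eq hxy hk)]
    exact mem_piece_of_mem_diff (hf.iterate_mem_diff hn hy hpy k)
  refine eq_of_isPeriodicPt_of_expanding hn hpx hpy fun k hk hne => hd _ _ (hsame k hk.le) ?_ hne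
  rw [← Function.iterate_succ_apply' f, ← Function.iterate_succ_apply' f]
  exact hsame (k + 1) hk

theorem bijOn_signWord (hf : IsGoldenUnimodal s f) (hdiff : Differentiable ℝ f)
    (hcrit : deriv f 0 = 0) {d : ℝ → ℝ → ℝ}
    (hd : ∀ x y, InSamePiece s x y → InSamePiece s (f x) (f y) → x ≠ y → d x y < d (f x) (f y))
    {n : ℕ} (hn : n ≠ 0) :
    Set.BijOn (signWord f n) ((Set.Icc (-s) 1 \ turningCycle s) ∩ Function.ptsOfPeriod f n)
      (goldenWords.cyclic n) := by
  refine ⟨fun x hx => hf.signWord_mem_cyclic hn hx.1 hx.2,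
    fun x hx y hy hxy => hf.eq_of_signWord_eq hd hn hx.1 hy.1 hx.2 hy.2 hxy, fun l hl => ?_⟩
  obtain ⟨x, hx, hper, hword⟩ := hf.exists_isPeriodicPt_signWord_eq hdiff hcrit hn hl
  exact ⟨x, ⟨hx, hper⟩, hword⟩

end IsGoldenUnimodal

/-! ### The Hilbert metric and cubics with real critical points -/

/-- The Hilbert distance between two points of the interval with endpoints `a` and `b`, the
absolute value of the logarithm of their cross-ratio with the endpoints. It does not depend on the
order of the endpoints. -/
noncomputable def hilbertDist (a b x y : ℝ) : ℝ :=
  |Real.log ((y - a) * (b - x) / ((x - a) * (b - y)))|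

theorem hilbertDist_self (a b x : ℝ) : hilbertDist a b x x = 0 := by
  rcases eq_or_ne ((x - a) * (b - x)) 0 with h | h <;> simp [hilbertDist, h]

theorem hilbertDist_comm (a b x y : ℝ) : hilbertDist a b x y = hilbertDist a b y x := by
  rw [hilbertDist, ← inv_div, Real.log_inv, abs_neg, hilbertDist]

theorem hilbertDist_swap (a b x y : ℝ) : hilbertDist a b x y = hilbertDist b a x y := by
  rw [hilbertDist, ← inv_div, Real.log_inv, abs_neg, hilbertDist]
  congr 2
  rw [← neg_sub a x, ← neg_sub y b, ← neg_sub a y, ← neg_sub x b]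
  simp only [neg_mul_neg]
  ring

theorem hilbertDist_of_lt {a b x y : ℝ} (hax : a < x) (hxy : x < y) (hyb : y < b) :
    hilbertDist a b x y = Real.log ((y - a) * (b - x) / ((x - a) * (b - y))) := by
  refine abs_of_nonneg (Real.log_nonneg ?_)
  rw [one_le_div (mul_pos (by linarith) (by linarith))]
  exact mul_le_mul (by linarith) (by linarith) (by linarith) (by linarith)

theorem hilbertDist_le_of_subinterval {a a' b b' x y : ℝ} (ha : a' ≤ a) (hb : b ≤ b')
    (hx : x ∈ Set.Ioo a b) (hy : y ∈ Set.Ioo a b) :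
    hilbertDist a' b' x y ≤ hilbertDist a b x y := by
  wlog hxy : x < y generalizing x y
  · rcases (not_lt.1 hxy).lt_or_eq with h | rfl
    · rw [hilbertDist_comm a', hilbertDist_comm a]
      exact this hy hx h
    · rw [hilbertDist_self, hilbertDist_self]
  obtain ⟨hax, -⟩ := hx
  obtain ⟨-, hyb⟩ := hy
  rw [hilbertDist_of_lt hax hxy hyb, hilbertDist_of_lt (ha.trans_lt hax) hxy (hyb.trans_le hb)]
  have hxa : 0 < x - a := sub_pos.2 hax
  have hby : 0 < b - y := sub_pos.2 hyb
  refine Real.log_le_log (by apply div_pos <;> apply mul_pos <;> linarith) ?_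
  rw [mul_div_mul_comm, mul_div_mul_comm]
  have hleft : (y - a') / (x - a') ≤ (y - a) / (x - a) := by
    rw [div_le_div_iff₀ (by linarith) hxa]
    nlinarith
  have hright : (b' - x) / (b' - y) ≤ (b - x) / (b - y) := by
    rw [div_le_div_iff₀ (by linarith) hby]
    nlinarith
  exact mul_le_mul hleft hright (by apply div_nonneg <;> linarith)
    (by apply div_nonneg <;> linarith)

theorem hilbertDist_lt_hilbertDist_map {f : ℝ → ℝ} {a b x y : ℝ} (hax : a < x) (hxy : x < y)
    (hyb : y < b) (hpos : 0 < slope f a x * slope f b y)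
    (hlt : slope f a x * slope f b y < slope f a y * slope f b x) :
    hilbertDist a b x y < hilbertDist (f a) (f b) (f x) (f y) := by
  have hfactor : (f y - f a) * (f b - f x) / ((f x - f a) * (f b - f y)) =
      (y - a) * (b - x) / ((x - a) * (b - y)) *
        (slope f a y * slope f b x / (slope f a x * slope f b y)) := by
    have hrw : ∀ u v, f v - f u = (v - u) * slope f u v := fun u v => by
      rw [← smul_eq_mul, sub_smul_slope, vsub_eq_sub]
    rw [hrw a y, hrw a x, ← neg_sub (f x) (f b), ← neg_sub (f y) (f b), hrw b x, hrw b y]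
    rw [← neg_sub x b, ← neg_sub y b, div_mul_div_comm]
    congr 1 <;> ring
  have hratio : 1 < (y - a) * (b - x) / ((x - a) * (b - y)) := by
    rw [one_lt_div (mul_pos (by linarith) (by linarith))]
    nlinarith
  rw [hilbertDist_of_lt hax hxy hyb, hilbertDist, hfactor]
  refine (Real.log_lt_log (one_pos.trans hratio) ?_).trans_le (le_abs_self _)
  exact lt_mul_of_one_lt_right (one_pos.trans hratio) ((one_lt_div hpos).2 hlt)

theorem slope_mul_slope_pos_of_injOn {f : ℝ → ℝ} {a b x y : ℝ}
    (hf : ContinuousOn f (Set.Icc a b)) (hinj : Set.InjOn f (Set.Icc a b)) (hax : a < x)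
    (hxy : x < y) (hyb : y < b) : 0 < slope f a x * slope f b y := by
  have ha : a ∈ Set.Icc a b := ⟨le_rfl, by linarith⟩
  have hx : x ∈ Set.Icc a b := ⟨by linarith, by linarith⟩
  have hy : y ∈ Set.Icc a b := ⟨by linarith, by linarith⟩
  have hb : b ∈ Set.Icc a b := ⟨by linarith, le_rfl⟩
  rcases hf.strictMonoOn_of_injOn_Icc' (by linarith) hinj with hmono | hanti
  · exact mul_pos (hmono.slope_pos ha hx hax.ne) (hmono.slope_pos hb hy hyb.ne')
  · exact mul_pos_of_neg_of_neg (hanti.slope_neg ha hx hax.ne) (hanti.slope_neg hb hy hyb.ne')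

section RealCriticalPoints

variable {A D c₁ c₂ : ℝ}

/-- The cubic polynomial map with derivative `3 A (t - c₁) (t - c₂)` and value `D` at `0`. -/
noncomputable def cubicWithCrit (A D c₁ c₂ t : ℝ) : ℝ :=
  A * (t ^ 3 - 3 * (c₁ + c₂) / 2 * t ^ 2 + 3 * c₁ * c₂ * t) + D

theorem slope_cubicWithCrit {u v : ℝ} (huv : u ≠ v) :
    slope (cubicWithCrit A D c₁ c₂) u v = A * ((u - c₁) * (u - c₂) + (v - c₁) * (v - c₂) +
      ((u - c₁) * (v - c₂) + (v - c₁) * (u - c₂)) / 2) := by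
  rw [slope_def_field, div_eq_iff (sub_ne_zero.2 huv.symm), cubicWithCrit, cubicWithCrit]
  ring

theorem hasDerivAt_cubicWithCrit (t : ℝ) :
    HasDerivAt (cubicWithCrit A D c₁ c₂) (3 * A * ((t - c₁) * (t - c₂))) t := by
  have h := ((((hasDerivAt_id t).pow 3).sub (((hasDerivAt_id t).pow 2).const_mul
    (3 * (c₁ + c₂) / 2))).add ((hasDerivAt_id t).const_mul (3 * c₁ * c₂))).const_mul A
  refine (h.add_const D).congr_deriv ?_
  simp only [id_eq]
  ring

theorem continuous_cubicWithCrit : Continuous (cubicWithCrit A D c₁ c₂) :=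
  continuous_iff_continuousAt.2 fun t => (hasDerivAt_cubicWithCrit t).continuousAt

theorem injOn_cubicWithCrit (hA : A ≠ 0) {a b : ℝ} (hc₁ : c₁ ∉ Set.Ioo a b)
    (hc₂ : c₂ ∉ Set.Ioo a b) : Set.InjOn (cubicWithCrit A D c₁ c₂) (Set.Icc a b) := by
  intro x hx y hy hxy
  by_contra hne
  wlog hlt : x < y generalizing x y
  · exact this hy hx hxy.symm (Ne.symm hne) (lt_of_le_of_ne (not_lt.1 hlt) (Ne.symm hne))
  obtain ⟨t, ht, h0⟩ := exists_hasDerivAt_eq_zero hlt continuous_cubicWithCrit.continuousOn hxy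
    fun t _ => hasDerivAt_cubicWithCrit t
  have htab : t ∈ Set.Ioo a b := ⟨hx.1.trans_lt ht.1, ht.2.trans_le hy.2⟩
  have hcrit : t = c₁ ∨ t = c₂ := by simpa [hA, sub_eq_zero] using h0
  rcases hcrit with rfl | rfl
  · exact hc₁ htab
  · exact hc₂ htab

theorem esymm_two_add_three_mul_sq_pos {a b x y d : ℝ} (hd : d ∉ Set.Ioo a b)
    (hd' : -d ∉ Set.Ioo a b) (hax : a < x) (hxy : x < y) (hyb : y < b) :
    0 < a * b + a * x + a * y + b * x + b * y + x * y + 3 * d ^ 2 := by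
  wlog hd0 : 0 ≤ d generalizing d
  · rw [← neg_sq d]
    exact this hd' (by rwa [neg_neg]) (by linarith)
  rw [Set.mem_Ioo, not_and_or, not_lt, not_lt] at hd hd'
  rcases hd with hda | hbd
  · have ha : 0 ≤ a := hd0.trans hda
    have hx : 0 < x := ha.trans_lt hax
    have hy : 0 < y := hx.trans hxy
    have hb : 0 < b := hy.trans hyb
    positivity
  rcases hd' with hda | hbd'
  · have hsq : ∀ u, a ≤ u → u ≤ b → 0 ≤ d ^ 2 - u ^ 2 := fun u _ _ =>
      sub_nonneg.2 (sq_le_sq' (by linarith) (by linarith))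
    have hx : 0 < d ^ 2 - x ^ 2 := sub_pos.2 (sq_lt_sq' (by linarith) (by linarith))
    linarith [sq_nonneg (a + b + x + y), sq_nonneg d, hsq a le_rfl (by linarith),
      hsq b (by linarith) le_rfl, hsq y (by linarith) hyb.le]
  · have hb : 0 ≤ -b := by linarith
    have hy : 0 < -y := by linarith
    have hx : 0 < -x := by linarith
    have ha : 0 < -a := by linarith
    have hneg : 0 < -a * -b + -a * -x + -a * -y + -b * -x + -b * -y + -x * -y + 3 * d ^ 2 := by
      positivity
    simpa only [neg_mul_neg] using hneg

theorem slope_cubicWithCrit_mul_lt (hA : A ≠ 0) {a b x y : ℝ} (hc₁ : c₁ ∉ Set.Ioo a b)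
    (hc₂ : c₂ ∉ Set.Ioo a b) (hax : a < x) (hxy : x < y) (hyb : y < b) :
    slope (cubicWithCrit A D c₁ c₂) a x * slope (cubicWithCrit A D c₁ c₂) b y <
      slope (cubicWithCrit A D c₁ c₂) a y * slope (cubicWithCrit A D c₁ c₂) b x := by
  rw [slope_cubicWithCrit hax.ne, slope_cubicWithCrit hyb.ne',
    slope_cubicWithCrit (hax.trans hxy).ne, slope_cubicWithCrit (hxy.trans hyb).ne', ← sub_pos]
  have hlen : 0 < A ^ 2 * ((b - a) * (y - x)) :=
    mul_pos (sq_pos_of_ne_zero hA) (mul_pos (by linarith) (by linarith))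
  have hshift : ∀ {c}, c ∉ Set.Ioo a b → c - (c₁ + c₂) / 2 ∉
      Set.Ioo (a - (c₁ + c₂) / 2) (b - (c₁ + c₂) / 2) := fun hc => by simpa using hc
  -- The difference of the two sides, in coordinates centred at the midpoint of `c₁` and `c₂`.
  refine (mul_pos hlen (esymm_two_add_three_mul_sq_pos (d := c₁ - (c₁ + c₂) / 2) (hshift hc₁) ?_
    (sub_lt_sub_right hax _) (sub_lt_sub_right hxy _) (sub_lt_sub_right hyb _))).trans_eq ?_
  · rw [show -(c₁ - (c₁ + c₂) / 2) = c₂ - (c₁ + c₂) / 2 by ring]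
    exact hshift hc₂
  · ring

theorem hilbertDist_lt_hilbertDist_cubicWithCrit (hA : A ≠ 0) {a b x y : ℝ}
    (hc₁ : c₁ ∉ Set.Ioo a b) (hc₂ : c₂ ∉ Set.Ioo a b) (hx : x ∈ Set.Ioo a b)
    (hy : y ∈ Set.Ioo a b) (hxy : x ≠ y) :
    hilbertDist a b x y < hilbertDist (cubicWithCrit A D c₁ c₂ a) (cubicWithCrit A D c₁ c₂ b)
      (cubicWithCrit A D c₁ c₂ x) (cubicWithCrit A D c₁ c₂ y) := by
  wlog hlt : x < y generalizing x y
  · rw [hilbertDist_comm a, hilbertDist_comm (cubicWithCrit A D c₁ c₂ a)]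
    exact this hy hx hxy.symm (hxy.lt_or_gt.resolve_left hlt)
  · exact hilbertDist_lt_hilbertDist_map hx.1 hlt hy.2
      (slope_mul_slope_pos_of_injOn continuous_cubicWithCrit.continuousOn
        (injOn_cubicWithCrit hA hc₁ hc₂) hx.1 hlt hy.2)
      (slope_cubicWithCrit_mul_lt hA hc₁ hc₂ hx.1 hlt hy.2)

end RealCriticalPoints

/-- The Hilbert distance in the piece of the Markov partition that contains `x`. -/
noncomputable def pieceDist (s x y : ℝ) : ℝ :=
  hilbertDist (pieceLeft s (decide (0 < x))) (pieceRight (decide (0 < x))) x y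

theorem IsGoldenUnimodal.pieceDist_lt_pieceDist_map {s A D c₁ c₂ : ℝ}
    (hf : IsGoldenUnimodal s (cubicWithCrit A D c₁ c₂)) (hA : A ≠ 0)
    (hc₁ : ∀ i, c₁ ∉ Set.Ioo (pieceLeft s i) (pieceRight i))
    (hc₂ : ∀ i, c₂ ∉ Set.Ioo (pieceLeft s i) (pieceRight i)) {x y : ℝ} (hxy : InSamePiece s x y)
    (hxy' : InSamePiece s (cubicWithCrit A D c₁ c₂ x) (cubicWithCrit A D c₁ c₂ y)) (hne : x ≠ y) :
    pieceDist s x y <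
      pieceDist s (cubicWithCrit A D c₁ c₂ x) (cubicWithCrit A D c₁ c₂ y) := by
  obtain ⟨i, hx, hy⟩ := hxy
  obtain ⟨k, hx', hy'⟩ := hxy'
  rw [pieceDist, decide_pos_eq_of_mem_piece hx, pieceDist, decide_pos_eq_of_mem_piece hx']
  refine (hilbertDist_lt_hilbertDist_cubicWithCrit (D := D) hA (hc₁ i) (hc₂ i) hx hy
    hne).trans_le ?_
  have hik : i = true ∨ k = true := by
    simpa only [← decide_pos_eq_of_mem_piece hx, ← decide_pos_eq_of_mem_piece hx',
      decide_eq_true_eq] using hf.pos_or_pos_map (hf.mem_diff_of_mem_piece hx)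
  cases i
  · obtain rfl : k = true := by simpa using hik
    simp [pieceLeft, pieceRight, hf.map_neg, hf.map_zero]
  · simp only [pieceLeft, pieceRight, if_true, hf.map_zero, hf.map_one]
    rw [hilbertDist_swap]
    refine hilbertDist_le_of_subinterval ?_ ?_ hx' hy' <;> cases k <;> simp [hf.pos.le]

/-! ### The cubic family -/

/-- The map `F_s : ℝ → ℝ`. -/
noncomputable def cubicMap (s x : ℝ) : ℝ := (cubicF s).eval x

/-- The nonzero critical point of `F_s`. -/
noncomputable def cubicCrit (s : ℝ) : ℝ := -2 * cubicB s / (3 * cubicA s)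

/-- The parameters considered: no critical point lies inside one of the pieces of the Markov
partition of `[-s, 1]`. -/
structure IsGoldenParam (s : ℝ) : Prop where
  one_le : 1 ≤ s
  crit_le : cubicCrit s ≤ -s

theorem cubicMap_apply (s x : ℝ) :
    cubicMap s x = cubicA s * x ^ 3 + cubicB s * x ^ 2 + 1 := by
  simp [cubicMap, cubicF]

theorem cubicMap_zero (s : ℝ) : cubicMap s 0 = 1 := by
  simp [cubicMap_apply]

theorem cubicA_add_cubicB (s : ℝ) : cubicA s + cubicB s = -1 - s := by
  rw [cubicA, cubicB]
  ring

theorem cubicMap_one (s : ℝ) : cubicMap s 1 = -s := by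
  linear_combination cubicMap_apply s 1 + cubicA_add_cubicB s

theorem cubicMap_neg {s : ℝ} (hs : 0 < s) : cubicMap s (-s) = 0 := by
  rw [cubicMap_apply, cubicA, cubicB]
  field_simp
  ring

theorem cubicA_le {s : ℝ} (hs : 1 ≤ s) : cubicA s ≤ -1 / 2 := by
  have hpos : 0 < s ^ 2 * (s + 1) := by positivity
  have h : 1 / (s ^ 2 * (s + 1)) ≤ 1 / 2 := by
    rw [div_le_div_iff₀ hpos two_pos]
    nlinarith [one_le_pow₀ hs (n := 2)]
  rw [cubicA]
  linarith

theorem cubicA_neg {s : ℝ} (hs : 1 ≤ s) : cubicA s < 0 :=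
  (cubicA_le hs).trans_lt (by norm_num)

theorem cubicMap_eq_cubicWithCrit {s : ℝ} (hs : 1 ≤ s) :
    cubicMap s = cubicWithCrit (cubicA s) 1 0 (cubicCrit s) := by
  have hA := (cubicA_neg hs).ne
  ext x
  rw [cubicMap_apply, cubicWithCrit, cubicCrit]
  field_simp
  ring

theorem cubicCrit_add_self {s : ℝ} (hs : 1 ≤ s) :
    cubicCrit s + s = (s ^ 3 * (s + 1) - (2 + 3 * s)) / (3 * (s ^ 2 * (s + 1) - 1)) := by
  have hA := (cubicA_neg hs).ne
  have hden : s ^ 2 * (s + 1) - 1 ≠ 0 := by nlinarith [one_le_pow₀ hs (n := 2)]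
  rw [cubicCrit, div_add' _ _ _ (by simpa using hA), div_eq_div_iff (by simpa using hA)
    (by simpa using hden), cubicA, cubicB]
  have := one_pos.trans_le hs
  field_simp
  ring

theorem cubicCrit_le_neg {s : ℝ} (hs : 1 ≤ s) (h : s ^ 3 * (s + 1) ≤ 2 + 3 * s) :
    cubicCrit s ≤ -s := by
  have hden : 0 ≤ s ^ 2 * (s + 1) - 1 := by nlinarith [one_le_pow₀ hs (n := 2)]
  rw [← sub_nonpos, sub_neg_eq_add, cubicCrit_add_self hs]
  exact div_nonpos_of_nonpos_of_nonneg (sub_nonpos.2 h) (by positivity)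

namespace IsGoldenParam

variable {s : ℝ}

theorem pos (h : IsGoldenParam s) : 0 < s := one_pos.trans_le h.one_le

theorem isGoldenUnimodal (h : IsGoldenParam s) : IsGoldenUnimodal s (cubicMap s) := by
  have hs := h.pos
  have hcont : Continuous (cubicMap s) := (cubicF s).continuous
  have hinj : ∀ {a b}, 0 ∉ Set.Ioo a b → -s ≤ a → Set.InjOn (cubicMap s) (Set.Icc a b) :=
    fun h0 ha => cubicMap_eq_cubicWithCrit h.one_le ▸
      injOn_cubicWithCrit (cubicA_neg h.one_le).ne h0 fun hc => by linarith [hc.1, h.crit_le]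
  refine ⟨hs, hcont, cubicMap_zero s, cubicMap_one s, cubicMap_neg hs, ?_, ?_⟩
  · refine (hcont.continuousOn.strictMonoOn_of_injOn_Icc' (by linarith)
      (hinj (by simp) le_rfl)).resolve_right fun hanti => ?_
    have := hanti ⟨le_rfl, by linarith⟩ ⟨by linarith, le_rfl⟩ (show -s < 0 by linarith)
    rw [cubicMap_zero, cubicMap_neg hs] at this
    linarith
  · refine (hcont.continuousOn.strictMonoOn_of_injOn_Icc' (by linarith)
      (hinj (by simp) (by linarith))).resolve_left fun hmono => ?_
    have := hmono ⟨le_rfl, zero_le_one⟩ ⟨zero_le_one, le_rfl⟩ zero_lt_one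
    rw [cubicMap_zero, cubicMap_one] at this
    linarith

theorem pieceDist_lt_pieceDist_map (h : IsGoldenParam s) {x y : ℝ} (hxy : InSamePiece s x y)
    (hxy' : InSamePiece s (cubicMap s x) (cubicMap s y)) (hne : x ≠ y) :
    pieceDist s x y < pieceDist s (cubicMap s x) (cubicMap s y) := by
  have hs := h.pos
  have hf := h.isGoldenUnimodal
  rw [cubicMap_eq_cubicWithCrit h.one_le] at hf hxy' ⊢
  refine hf.pieceDist_lt_pieceDist_map (cubicA_neg h.one_le).ne (fun i => ?_) (fun i => ?_)
    hxy hxy' hne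
  · cases i <;> simp [pieceLeft, pieceRight]
  · have := h.crit_le
    rintro ⟨hl, -⟩
    cases i <;> simp only [pieceLeft, Bool.false_eq_true, if_false, if_true] at hl <;> linarith

end IsGoldenParam

/-! ### The cubic family outside the Markov interval -/

namespace IsGoldenParam

variable {s : ℝ}

theorem le_three_halves (h : IsGoldenParam s) : s ≤ 3 / 2 := by
  have hs := h.one_le
  have hden : 0 < 3 * (s ^ 2 * (s + 1) - 1) := by nlinarith [one_le_pow₀ hs (n := 2)]
  have hcrit : cubicCrit s + s ≤ 0 := by linarith [h.crit_le]
  rw [cubicCrit_add_self hs, div_le_iff₀ hden] at hcrit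
  nlinarith [mul_nonneg (sub_nonneg.2 hs) (sub_nonneg.2 hs)]

theorem cubicA_le_neg_half (h : IsGoldenParam s) : cubicA s ≤ -s / 2 := by
  have hs := h.one_le
  have hpos : 0 < s ^ 2 * (s + 1) := by positivity
  suffices 1 / (s ^ 2 * (s + 1)) ≤ 1 - s / 2 by rw [cubicA]; linarith
  rw [div_le_iff₀ hpos]
  have hgap : 0 ≤ (s - 1) * (3 / 2 - s) :=
    mul_nonneg (sub_nonneg.2 hs) (sub_nonneg.2 h.le_three_halves)
  nlinarith [mul_nonneg hgap h.pos.le]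

theorem cubicB_mem_Icc (h : IsGoldenParam s) : cubicB s ∈ Set.Icc (-1 - s / 2) (-1) := by
  have hA := h.cubicA_le_neg_half
  have hAB := cubicA_add_cubicB s
  refine ⟨by linarith, ?_⟩
  have hpos : 0 < 1 / (s ^ 2 * (s + 1)) := by have := h.pos; positivity
  rw [cubicB]
  linarith [h.one_le]

theorem neg_le_cubicMap (h : IsGoldenParam s) {x : ℝ} (hx : x ≤ 0) : -s ≤ cubicMap s x := by
  have hs := h.pos
  have hA := h.cubicA_le_neg_half
  have hcrit : -s ≤ cubicMap s (cubicCrit s) := by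
    have hA0 : cubicA s ≠ 0 := by linarith
    have hval : cubicMap s (cubicCrit s) = 1 + 4 * cubicB s ^ 3 / (27 * cubicA s ^ 2) := by
      rw [cubicMap_apply, cubicCrit]
      field_simp
      ring
    have hB : (-cubicB s) ^ 3 ≤ (1 + s / 2) ^ 3 :=
      pow_le_pow_left₀ (by linarith [h.cubicB_mem_Icc.2]) (by linarith [h.cubicB_mem_Icc.1]) 3
    have hAsq : (s / 2) ^ 2 ≤ cubicA s ^ 2 := by nlinarith
    rw [hval, ← sub_le_iff_le_add', le_div_iff₀ (by positivity)]
    have hpoly : 4 * (1 + s / 2) ^ 3 ≤ 27 * (1 + s) * (s / 2) ^ 2 := by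
      nlinarith [h.one_le, one_le_pow₀ h.one_le (n := 2)]
    nlinarith
  have hdiff : cubicMap s x - cubicMap s (cubicCrit s) =
      cubicA s * ((x - cubicCrit s) ^ 2 * (x + cubicCrit s / 2)) := by
    rw [cubicMap_eq_cubicWithCrit h.one_le, cubicWithCrit, cubicWithCrit]
    ring
  have hnonneg : 0 ≤ cubicA s * ((x - cubicCrit s) ^ 2 * (x + cubicCrit s / 2)) :=
    mul_nonneg_of_nonpos_of_nonpos (by linarith)
      (mul_nonpos_of_nonneg_of_nonpos (sq_nonneg _) (by linarith [h.crit_le]))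
  linarith

theorem cubicMap_lt_neg (h : IsGoldenParam s) {x : ℝ} (hx : 1 < x) : cubicMap s x < -s := by
  have hcube : cubicA s * x ^ 3 < cubicA s :=
    mul_lt_of_one_lt_right (cubicA_neg h.one_le) (one_lt_pow₀ hx (by norm_num))
  have hsq : cubicB s * x ^ 2 < cubicB s :=
    mul_lt_of_one_lt_right (by linarith [h.cubicB_mem_Icc.2]) (one_lt_pow₀ hx (by norm_num))
  rw [cubicMap_apply]
  linarith [cubicA_add_cubicB s]

theorem one_lt_cubicMap (h : IsGoldenParam s) {x : ℝ} (hx : x ∉ Set.Icc (-s) 1)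
    (hfx : cubicMap s x ∉ Set.Icc (-s) 1) (hx1 : ¬ 1 < x) : 1 < cubicMap s x := by
  have hs := h.pos
  have hxs : x < -s := by
    by_contra hxs
    exact hx ⟨not_lt.1 hxs, not_lt.1 hx1⟩
  by_contra hfx1
  exact hfx ⟨h.neg_le_cubicMap (by linarith), not_lt.1 hfx1⟩

theorem one_lt_cubicMap_iff (h : IsGoldenParam s) {x : ℝ} (hx : x ∉ Set.Icc (-s) 1)
    (hfx : cubicMap s x ∉ Set.Icc (-s) 1) : 1 < cubicMap s x ↔ ¬ 1 < x := by
  refine ⟨fun hfx1 hx1 => ?_, h.one_lt_cubicMap hx hfx⟩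
  linarith [h.cubicMap_lt_neg hx1, h.pos]

theorem lt_of_one_lt_cubicMap (h : IsGoldenParam s) {x : ℝ} (hx : 1 < cubicMap s x) :
    x < 3 / 2 * cubicCrit s := by
  by_contra hle
  have hfactor : cubicMap s x - 1 = cubicA s * (x ^ 2 * (x - 3 / 2 * cubicCrit s)) := by
    rw [cubicMap_eq_cubicWithCrit h.one_le, cubicWithCrit]
    ring
  have := mul_nonpos_of_nonpos_of_nonneg (cubicA_neg h.one_le).le
    (mul_nonneg (sq_nonneg x) (sub_nonneg.2 (not_lt.1 hle)))
  linarith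

theorem abs_sub_lt_abs_cubicMap_sub (h : IsGoldenParam s) {x y : ℝ}
    (hx : x ∉ Set.Icc (-s) 1) (hy : y ∉ Set.Icc (-s) 1) (hfx : cubicMap s x ∉ Set.Icc (-s) 1)
    (hfy : cubicMap s y ∉ Set.Icc (-s) 1) (hside : 1 < x ↔ 1 < y) (hne : x ≠ y) :
    |x - y| < |cubicMap s x - cubicMap s y| := by
  have hs := h.one_le
  have hc := h.crit_le
  have hmul : ∀ u v, (1 < u ∧ 1 < v) ∨ (u < 3 / 2 * cubicCrit s ∧ v < 3 / 2 * cubicCrit s) →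
      3 / 4 ≤ u * (v - cubicCrit s) := by
    rintro u v (⟨hu, hv⟩ | ⟨hu, hv⟩) <;> nlinarith
  have hsides : (1 < x ∧ 1 < y) ∨ (x < 3 / 2 * cubicCrit s ∧ y < 3 / 2 * cubicCrit s) := by
    by_cases hx1 : 1 < x
    · exact .inl ⟨hx1, hside.1 hx1⟩
    · exact .inr ⟨h.lt_of_one_lt_cubicMap (h.one_lt_cubicMap hx hfx hx1),
        h.lt_of_one_lt_cubicMap (h.one_lt_cubicMap hy hfy (hside.not.1 hx1))⟩
  have hslope : slope (cubicMap s) y x < -1 := by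
    rw [cubicMap_eq_cubicWithCrit hs, slope_cubicWithCrit hne.symm]
    simp only [sub_zero]
    have hxx := hmul x x (hsides.imp (fun h => ⟨h.1, h.1⟩) fun h => ⟨h.1, h.1⟩)
    have hyy := hmul y y (hsides.imp (fun h => ⟨h.2, h.2⟩) fun h => ⟨h.2, h.2⟩)
    have hxy := hmul x y hsides
    have hyx := hmul y x (hsides.imp And.symm And.symm)
    nlinarith [cubicA_le hs]
  have hdiff : cubicMap s x - cubicMap s y = (x - y) * slope (cubicMap s) y x := by
    rw [← smul_eq_mul, sub_smul_slope, vsub_eq_sub]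
  rw [hdiff, abs_mul]
  exact lt_mul_of_one_lt_right (abs_pos.2 (sub_ne_zero.2 hne)) (lt_abs.2 (.inr (by linarith)))

theorem eq_of_isPeriodicPt_of_notMem (h : IsGoldenParam s) {n : ℕ} (hn : n ≠ 0) {x y : ℝ}
    (hx : x ∉ Set.Icc (-s) 1) (hy : y ∉ Set.Icc (-s) 1)
    (hpx : Function.IsPeriodicPt (cubicMap s) n x) (hpy : Function.IsPeriodicPt (cubicMap s) n y)
    (hside : 1 < x ↔ 1 < y) : x = y := by
  have hout : ∀ {z}, z ∉ Set.Icc (-s) 1 → Function.IsPeriodicPt (cubicMap s) n z →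
      ∀ k, (cubicMap s)^[k] z ∉ Set.Icc (-s) 1 := fun hz hpz =>
    iterate_notMem_of_isPeriodicPt h.isGoldenUnimodal.mapsTo_Icc hn hpz hz
  have hout' : ∀ {z}, z ∉ Set.Icc (-s) 1 → Function.IsPeriodicPt (cubicMap s) n z →
      ∀ k, cubicMap s ((cubicMap s)^[k] z) ∉ Set.Icc (-s) 1 := fun hz hpz k => by
    rw [← Function.iterate_succ_apply' (cubicMap s)]
    exact hout hz hpz (k + 1)
  have hsides : ∀ k, 1 < (cubicMap s)^[k] x ↔ 1 < (cubicMap s)^[k] y := by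
    intro k
    induction k with
    | zero => exact hside
    | succ k ih =>
      rw [Function.iterate_succ_apply', Function.iterate_succ_apply',
        h.one_lt_cubicMap_iff (hout hx hpx k) (hout' hx hpx k),
        h.one_lt_cubicMap_iff (hout hy hpy k) (hout' hy hpy k), ih]
  exact eq_of_isPeriodicPt_of_expanding (d := fun x y => |x - y|) hn hpx hpy fun k _ hne =>
    h.abs_sub_lt_abs_cubicMap_sub (hout hx hpx k) (hout hy hpy k) (hout' hx hpx k)
      (hout' hy hpy k) (hsides k) hne

theorem exists_outer_cycle (h : IsGoldenParam s) :
    ∃ p, 1 < p ∧ cubicMap s p < -s ∧ Function.IsPeriodicPt (cubicMap s) 2 p := by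
  have hcont := h.isGoldenUnimodal.continuous
  have h10 : 10 < cubicMap s (cubicMap s 10) := by
    have hA := cubicA_le h.one_le
    have hB := h.cubicB_mem_Icc
    have hs := h.le_three_halves
    have hfar : cubicMap s 10 ≤ -10 := by
      rw [cubicMap_apply]
      linarith [hB.2]
    have hslope : 3 ≤ cubicA s * cubicMap s 10 + cubicB s := by nlinarith [hB.1]
    have hsq : 100 ≤ cubicMap s 10 ^ 2 := by nlinarith
    rw [cubicMap_apply s (cubicMap s 10)]
    nlinarith
  obtain ⟨p, ⟨hp1, -⟩, hp⟩ := intermediate_value_Ioo (f := fun x => cubicMap s (cubicMap s x) - x)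
    (show (1 : ℝ) ≤ 10 by norm_num) ((hcont.comp hcont).sub continuous_id).continuousOn
    (show (0 : ℝ) ∈ _ from ⟨by
      rw [cubicMap_one, cubicMap_neg h.pos]
      norm_num, by linarith⟩)
  exact ⟨p, hp1, h.cubicMap_lt_neg hp1, sub_eq_zero.1 hp⟩

end IsGoldenParam

theorem IsGoldenUnimodal.turningCycle_inter_ptsOfPeriod {s : ℝ} {f : ℝ → ℝ}
    (hf : IsGoldenUnimodal s f) (n : ℕ) :
    turningCycle s ∩ Function.ptsOfPeriod f n = if 3 ∣ n then turningCycle s else ∅ := by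
  ext x
  have hx := hf.isPeriodicPt_iff_three_dvd (x := x) (n := n)
  split_ifs with h3
  · exact ⟨And.left, fun hxT => ⟨hxT, (hx hxT).2 h3⟩⟩
  · exact ⟨fun ⟨hxT, hxP⟩ => h3 ((hx hxT).1 hxP), False.elim⟩

theorem ncard_turningCycle {s : ℝ} (hs : 0 < s) : (turningCycle s).ncard = 3 := by
  rw [turningCycle, Set.ncard_eq_three]
  exact ⟨0, 1, -s, by norm_num, by linarith, by linarith, rfl⟩

namespace IsGoldenParam

variable {s : ℝ}

theorem exists_ptsOfPeriod_diff_Icc_eq (h : IsGoldenParam s) :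
    ∃ p q, p ≠ q ∧ ∀ n ≠ 0, Function.ptsOfPeriod (cubicMap s) n \ Set.Icc (-s) 1 =
      if 2 ∣ n then {p, q} else ∅ := by
  obtain ⟨p, hp1, hq, hp⟩ := h.exists_outer_cycle
  have hs := h.pos
  have hpq : cubicMap s p < p := by linarith
  have hpout : p ∉ Set.Icc (-s) 1 := fun hmem => hp1.not_ge hmem.2
  have hqout : cubicMap s p ∉ Set.Icc (-s) 1 := fun hmem => hq.not_ge hmem.1
  have hp2 := isPeriodicPt_iff_dvd_of_prime hp hpq.ne
  have hq2 := isPeriodicPt_iff_dvd_of_prime (hp.apply_iterate 1) (x := cubicMap s p)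
    (by rw [Function.IsFixedPt, show cubicMap s (cubicMap s p) = p from hp]; exact hpq.ne')
  have houter : ∀ n ≠ 0, ∀ x ∉ Set.Icc (-s) 1, Function.IsPeriodicPt (cubicMap s) n x →
      x = p ∨ x = cubicMap s p := fun n hn x hx hxn => by
    have huniq := fun {y} (hy : y ∉ Set.Icc (-s) 1) (hy2 : Function.IsPeriodicPt _ 2 y) =>
      h.eq_of_isPeriodicPt_of_notMem (mul_ne_zero hn two_ne_zero) hx hy (hxn.mul_const 2)
        (hy2.const_mul n)
    by_cases hx1 : 1 < x
    · exact .inl (huniq hpout hp ⟨fun _ => hp1, fun _ => hx1⟩)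
    · exact .inr (huniq hqout (hp.apply_iterate 1)
        ⟨fun h1 => (hx1 h1).elim, fun h1 => by linarith [show cubicMap s p > 1 from h1]⟩)
  refine ⟨p, cubicMap s p, hpq.ne', fun n hn => Set.ext fun x => ?_⟩
  split_ifs with h2
  · refine ⟨fun hx => houter n hn x hx.2 hx.1, ?_⟩
    rintro (rfl | rfl)
    exacts [⟨(hp2 n).2 h2, hpout⟩, ⟨(hq2 n).2 h2, hqout⟩]
  · refine ⟨fun ⟨hxn, hx⟩ => h2 ?_, False.elim⟩
    rcases houter n hn x hx hxn with rfl | rfl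
    exacts [(hp2 n).1 hxn, (hq2 n).1 hxn]

theorem bijOn_signWord (h : IsGoldenParam s) {n : ℕ} (hn : n ≠ 0) :
    Set.BijOn (signWord (cubicMap s) n)
      ((Set.Icc (-s) 1 \ turningCycle s) ∩ Function.ptsOfPeriod (cubicMap s) n)
      (goldenWords.cyclic n) := by
  refine h.isGoldenUnimodal.bijOn_signWord (d := pieceDist s) (cubicF s).differentiable ?_
    (fun _ _ => h.pieceDist_lt_pieceDist_map) hn
  rw [cubicMap_eq_cubicWithCrit h.one_le, (hasDerivAt_cubicWithCrit _).deriv]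
  ring

theorem finite_ptsOfPeriod (h : IsGoldenParam s) {n : ℕ} (hn : n ≠ 0) :
    (Function.ptsOfPeriod (cubicMap s) n).Finite := by
  obtain ⟨p, q, -, hpq⟩ := h.exists_ptsOfPeriod_diff_Icc_eq
  have houter : (Function.ptsOfPeriod (cubicMap s) n \ Set.Icc (-s) 1).Finite := by
    rw [hpq n hn]
    split_ifs <;> simp
  have hinner := (h.bijOn_signWord hn).finite_iff_finite.2 (Finset.finite_toSet _)
  have hturning : (turningCycle s).Finite := by simp [turningCycle]
  refine ((houter.union hinner).union hturning).subset fun x hx => ?_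
  by_cases hxI : x ∈ Set.Icc (-s) 1
  · by_cases hxT : x ∈ turningCycle s
    exacts [.inr hxT, .inl (.inr ⟨⟨hxI, hxT⟩, hx⟩)]
  · exact .inl (.inl ⟨hx, hxI⟩)

theorem numIsolatedFixedPts_cubicMap (h : IsGoldenParam s) (m : ℕ) :
    numIsolatedFixedPts (cubicMap s) (m + 1) =
      (if 3 ∣ m + 1 then 3 else 0) + (if 2 ∣ m + 1 then 2 else 0) +
        (Nat.fib (m + 2) + Nat.fib m) := by
  have hfin := h.finite_ptsOfPeriod m.succ_ne_zero
  obtain ⟨p, q, hne, hpq⟩ := h.exists_ptsOfPeriod_diff_Icc_eq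
  have hTI : turningCycle s ⊆ Set.Icc (-s) 1 := by
    have := h.pos
    rintro x (rfl | rfl | rfl) <;> constructor <;> linarith
  have hturning : (turningCycle s ∩ Function.ptsOfPeriod (cubicMap s) (m + 1)).ncard =
      if 3 ∣ m + 1 then 3 else 0 := by
    rw [h.isGoldenUnimodal.turningCycle_inter_ptsOfPeriod]
    split_ifs
    exacts [ncard_turningCycle h.pos, Set.ncard_empty _]
  have houter : (Function.ptsOfPeriod (cubicMap s) (m + 1) \ Set.Icc (-s) 1).ncard =
      if 2 ∣ m + 1 then 2 else 0 := by
    rw [hpq _ m.succ_ne_zero]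
    split_ifs
    exacts [Set.ncard_pair hne, Set.ncard_empty _]
  have hinner := (h.bijOn_signWord m.succ_ne_zero).ncard_eq
  rw [Set.ncard_coe_finset, goldenWords.card_cyclic] at hinner
  rw [numIsolatedFixedPts_eq_ncard hfin,
    ← Set.ncard_inter_add_ncard_sdiff_eq_ncard _ (Set.Icc (-s) 1) hfin, houter,
    ← Set.ncard_inter_add_ncard_sdiff_eq_ncard _ (turningCycle s) (hfin.inter_of_left _),
    Set.inter_assoc, Set.inter_eq_right.2 hTI, Set.inter_comm, hturning,
    Set.inter_sdiff_assoc, Set.inter_comm _ (_ \ _), hinner]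
  ring

theorem artinMazurZeta_cubicMap (h : IsGoldenParam s) :
    artinMazurZeta (cubicMap s) =
      ((1 - PowerSeries.X ^ 3) * (1 - PowerSeries.X ^ 2) *
        (1 - PowerSeries.X - PowerSeries.X ^ 2))⁻¹ :=
  artinMazurZeta_eq_of_golden_count h.numIsolatedFixedPts_cubicMap

end IsGoldenParam

/-! ### Tent map coordinates -/

/-- The coordinate on `X` in which `f` becomes the map `u ↦ 1 - β |u|`, when `g` tells the sign
of `u`. -/
noncomputable def tentCoord {X : Type*} (β : ℝ) (f : X → X) (g : X → ℝ) (x : X) : ℝ :=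
  ∑' n : ℕ, (-1) ^ n * (∏ k ∈ Finset.range (n + 1), (SignType.sign (g (f^[k] x)) : ℝ)) / β ^ (n + 1)

section TentCoord

variable {X Y : Type*} {β : ℝ} {f : X → X} {g : X → ℝ}

theorem abs_sign_le_one (r : ℝ) : |(SignType.sign r : ℝ)| ≤ 1 := by
  cases SignType.sign r <;> simp

theorem tentCoord_semiconj {f' : Y → Y} {g' : Y → ℝ} {e : X → Y} (he : Function.Semiconj e f f')
    (x : X) : tentCoord β f (g' ∘ e) x = tentCoord β f' g' (e x) := by
  simp only [tentCoord, Function.comp_apply, (he.iterate_right _).eq]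

theorem norm_tentCoord_term_le (hβ : 1 < β) (x : X) (n : ℕ) :
    ‖(-1) ^ n * (∏ k ∈ Finset.range (n + 1), (SignType.sign (g (f^[k] x)) : ℝ)) / β ^ (n + 1)‖ ≤
      β⁻¹ * β⁻¹ ^ n := by
  have hβ0 := zero_lt_one.trans hβ
  have hprod : |∏ k ∈ Finset.range (n + 1), (SignType.sign (g (f^[k] x)) : ℝ)| ≤ 1 := by
    rw [Finset.abs_prod]
    exact Finset.prod_le_one (fun _ _ => abs_nonneg _) fun _ _ => abs_sign_le_one _
  rw [← pow_succ', inv_pow, Real.norm_eq_abs, abs_div, abs_mul, abs_pow, abs_neg, abs_one, one_pow,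
    one_mul, abs_of_pos (pow_pos hβ0 _), div_eq_mul_inv]
  exact mul_le_of_le_one_left (by positivity) hprod

theorem abs_tentCoord_le (hβ : 1 < β) (x : X) : |tentCoord β f g x| ≤ β⁻¹ * (1 - β⁻¹)⁻¹ :=
  tsum_of_norm_bounded ((hasSum_geometric_of_lt_one (inv_nonneg.2 (zero_le_one.trans hβ.le))
    (inv_lt_one_of_one_lt₀ hβ)).mul_left _) (norm_tentCoord_term_le hβ x)

theorem tentCoord_eq (hβ : 1 < β) (x : X) :
    tentCoord β f g x = SignType.sign (g x) * (1 - tentCoord β f g (f x)) / β := by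
  have hsum := Summable.of_norm_bounded ((summable_geometric_of_lt_one
    (inv_nonneg.2 (zero_le_one.trans hβ.le)) (inv_lt_one_of_one_lt₀ hβ)).mul_left β⁻¹)
    (norm_tentCoord_term_le (f := f) (g := g) hβ x)
  have hshift : ∀ n : ℕ, (-1) ^ (n + 1) * (∏ k ∈ Finset.range (n + 1 + 1),
      (SignType.sign (g (f^[k] x)) : ℝ)) / β ^ (n + 1 + 1) = -(SignType.sign (g x) / β) *
      ((-1) ^ n * (∏ k ∈ Finset.range (n + 1), (SignType.sign (g (f^[k] (f x))) : ℝ)) /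
        β ^ (n + 1)) := fun n => by
    rw [Finset.prod_range_succ']
    simp only [Function.iterate_succ_apply, Function.iterate_zero_apply]
    have := zero_lt_one.trans hβ
    field_simp
    ring
  rw [tentCoord, hsum.tsum_eq_zero_add, tsum_congr hshift, tsum_mul_left]
  simp only [pow_zero, zero_add, Finset.prod_range_one, Function.iterate_zero_apply, pow_one,
    tentCoord]
  ring

theorem tentCoord_eq_zero (hβ : 1 < β) {x : X} (hx : g x = 0) : tentCoord β f g x = 0 := by
  simp [tentCoord_eq hβ x, hx]

theorem tentCoord_of_pos (hβ : 1 < β) {x : X} (hx : 0 < g x) :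
    tentCoord β f g x = (1 - tentCoord β f g (f x)) / β := by
  simp [tentCoord_eq hβ x, sign_pos hx]

theorem tentCoord_of_neg (hβ : 1 < β) {x : X} (hx : g x < 0) :
    tentCoord β f g x = -(1 - tentCoord β f g (f x)) / β := by
  simp [tentCoord_eq hβ x, sign_neg hx]

theorem exists_tentCoord_eq_add_mul_iterate (hβ : 1 < β) {K : Subfield ℝ} (hβK : β ∈ K) (x : X)
    (n : ℕ) : ∃ a ∈ K, ∃ b ∈ K, |b| ≤ β⁻¹ ^ n ∧
      tentCoord β f g x = a + b * tentCoord β f g (f^[n] x) := by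
  induction n generalizing x with
  | zero => exact ⟨0, K.zero_mem, 1, K.one_mem, by simp, by simp⟩
  | succ n ih =>
    obtain ⟨a, ha, b, hb, hbn, hx⟩ := ih (f x)
    have hsign : (SignType.sign (g x) : ℝ) / β ∈ K := by
      refine K.div_mem ?_ hβK
      cases SignType.sign (g x) <;> simp
    have hβ0 := zero_lt_one.trans hβ
    refine ⟨_, K.mul_mem hsign (K.sub_mem K.one_mem ha), _, K.neg_mem (K.mul_mem hsign hb), ?_, ?_⟩
    · rw [abs_neg, abs_mul, abs_div, abs_of_pos hβ0, div_eq_mul_inv, pow_succ']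
      gcongr
      exact mul_le_of_le_one_left (by positivity) (abs_sign_le_one _)
    · rw [tentCoord_eq hβ x, hx, Function.iterate_succ_apply]
      ring

theorem tentCoord_mem_subfield (hβ : 1 < β) {K : Subfield ℝ} (hβK : β ∈ K) {x : X} {i j : ℕ}
    (hij : i < j) (h : tentCoord β f g (f^[i] x) = tentCoord β f g (f^[j] x)) :
    tentCoord β f g x ∈ K := by
  have hcycle : tentCoord β f g (f^[i] x) ∈ K := by
    obtain ⟨a, ha, b, hb, hbn, hx⟩ :=
      exists_tentCoord_eq_add_mul_iterate (f := f) (g := g) hβ hβK (f^[i] x) (j - i)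
    rw [← Function.iterate_add_apply, Nat.sub_add_cancel hij.le, ← h] at hx
    have hb1 : b < 1 := (le_abs_self b).trans_lt <| hbn.trans_lt <|
      pow_lt_one₀ (inv_nonneg.2 (zero_le_one.trans hβ.le)) (inv_lt_one_of_one_lt₀ hβ) (by omega)
    rw [show tentCoord β f g (f^[i] x) = a / (1 - b) by
      rw [eq_div_iff (sub_pos.2 hb1).ne']; linear_combination hx]
    exact K.div_mem ha (K.sub_mem K.one_mem hb)
  obtain ⟨a, ha, b, hb, -, hx⟩ := exists_tentCoord_eq_add_mul_iterate (f := f) (g := g) hβ hβK x i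
  exact hx ▸ K.add_mem ha (K.mul_mem hb hcycle)

variable [TopologicalSpace X]

-- At a zero of `g` both one-sided branches of the inverse tent map meet, as `h (f x) = 1` there.
theorem eventually_abs_tentCoord_sub_le (hβ : 1 < β) (hg : Continuous g)
    (hzero : ∀ x, g x = 0 → tentCoord β f g (f x) = 1) (x₀ : X) :
    ∀ᶠ x in 𝓝 x₀, |tentCoord β f g x - tentCoord β f g x₀| ≤
      |tentCoord β f g (f x) - tentCoord β f g (f x₀)| / β := by
  have hβ0 := zero_lt_one.trans hβ
  have hbranch : ∀ x, SignType.sign (g x) = SignType.sign (g x₀) ∨ g x₀ = 0 →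
      |tentCoord β f g x - tentCoord β f g x₀| ≤
        |tentCoord β f g (f x) - tentCoord β f g (f x₀)| / β := by
    intro x hx
    have hdiff : tentCoord β f g x - tentCoord β f g x₀ = SignType.sign (g x) *
        ((tentCoord β f g (f x₀) - tentCoord β f g (f x)) / β) := by
      rw [tentCoord_eq hβ x, tentCoord_eq hβ x₀]
      rcases hx with hx | hx
      · rw [hx]
        ring
      · rw [hzero x₀ hx, hx]
        simp only [sign_zero, SignType.coe_zero]
        ring
    rw [hdiff, abs_mul, abs_div, abs_of_pos hβ0, abs_sub_comm]
    exact mul_le_of_le_one_left (by positivity) (abs_sign_le_one _)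
  rcases eq_or_ne (g x₀) 0 with h0 | h0
  · exact .of_forall fun x => hbranch x (.inr h0)
  · filter_upwards [((continuousAt_sign_of_ne_zero h0).comp hg.continuousAt).preimage_mem_nhds
      (mem_nhds_discrete.2 (Set.mem_singleton _))] with x hx using hbranch x (.inl hx)

theorem eventually_abs_tentCoord_sub_le_iterate (hβ : 1 < β) (hf : Continuous f)
    (hg : Continuous g) (hzero : ∀ x, g x = 0 → tentCoord β f g (f x) = 1) (n : ℕ) (x₀ : X) :
    ∀ᶠ x in 𝓝 x₀, |tentCoord β f g x - tentCoord β f g x₀| ≤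
      |tentCoord β f g (f^[n] x) - tentCoord β f g (f^[n] x₀)| / β ^ n := by
  induction n generalizing x₀ with
  | zero => simp
  | succ n ih =>
    filter_upwards [eventually_abs_tentCoord_sub_le hβ hg hzero x₀,
      hf.continuousAt.eventually (ih (f x₀))] with x hstep hx
    refine hstep.trans ?_
    rw [pow_succ, ← div_div]
    have := zero_lt_one.trans hβ
    gcongr
    exact hx

theorem continuous_tentCoord (hβ : 1 < β) (hf : Continuous f) (hg : Continuous g)
    (hzero : ∀ x, g x = 0 → tentCoord β f g (f x) = 1) : Continuous (tentCoord β f g) := by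
  refine continuous_iff_continuousAt.2 fun x₀ => Metric.tendsto_nhds.2 fun ε hε => ?_
  obtain ⟨n, hn⟩ : ∃ n : ℕ, 2 * (β⁻¹ * (1 - β⁻¹)⁻¹) / β ^ n < ε :=
    (((tendsto_pow_atTop_atTop_of_one_lt hβ).const_div_atTop _).eventually_lt_const hε).exists
  filter_upwards [eventually_abs_tentCoord_sub_le_iterate hβ hf hg hzero n x₀] with x hx
  refine (hx.trans ?_).trans_lt hn
  have := zero_lt_one.trans hβ
  gcongr
  refine (abs_sub _ _).trans ?_
  rw [two_mul]
  exact add_le_add (abs_tentCoord_le hβ _) (abs_tentCoord_le hβ _)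

theorem exists_tentCoord_iterate_eq_of_tendsto (hβ : 1 < β) (hf : Continuous f)
    (hg : Continuous g) (hzero : ∀ x, g x = 0 → tentCoord β f g (f x) = 1) {x₀ c : X} {n m : ℕ}
    (hn : n ≠ 0) (hx₀ : Function.IsPeriodicPt f n x₀)
    (hc : Tendsto (fun k : ℕ => f^[k * n + m] c) atTop (𝓝 x₀)) :
    ∃ i j, i < j ∧ tentCoord β f g (f^[i] c) = tentCoord β f g (f^[j] c) := by
  set u : ℕ → ℝ := fun k => |tentCoord β f g (f^[k * n + m] c) - tentCoord β f g x₀|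
  have hlim : Tendsto u atTop (𝓝 0) := by
    simpa using ((((continuous_tentCoord hβ hf hg hzero).tendsto x₀).comp hc).sub_const
      (tentCoord β f g x₀)).abs
  obtain ⟨K, hK⟩ := eventually_atTop.1
    (hc.eventually (eventually_abs_tentCoord_sub_le_iterate hβ hf hg hzero n x₀))
  have hmono : ∀ k ≥ K, u k ≤ u (k + 1) := fun k hk => by
    have hstep := hK k hk
    rw [← Function.iterate_add_apply, show n + (k * n + m) = (k + 1) * n + m by ring, hx₀.eq]
      at hstep
    exact hstep.trans (div_le_self (abs_nonneg _) (one_le_pow₀ hβ.le))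
  have hzero' : ∀ k ≥ K, tentCoord β f g (f^[k * n + m] c) = tentCoord β f g x₀ := fun k hk => by
    have hle : u k ≤ 0 := ge_of_tendsto hlim <| (eventually_ge_atTop k).mono fun l hl =>
      Nat.le_induction le_rfl (fun l hl h => h.trans (hmono l (hk.trans hl))) l hl
    exact sub_eq_zero.1 (abs_nonpos_iff.1 hle)
  refine ⟨K * n + m, (K + 1) * n + m, ?_, (hzero' K le_rfl).trans (hzero' (K + 1) (by omega)).symm⟩
  have := Nat.pos_of_ne_zero hn
  gcongr
  omega

end TentCoord

theorem tentCoord_goldenRatio_map_eq_one {X : Type*} {f : X → X} {g : X → ℝ} {x : X}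
    (h₁ : 0 < g (f x)) (h₂ : g (f (f x)) < 0) (h₃ : g (f (f (f x))) = 0) :
    tentCoord Real.goldenRatio f g (f x) = 1 := by
  have hφ := Real.one_lt_goldenRatio
  rw [tentCoord_of_pos hφ h₁, tentCoord_of_neg hφ h₂, tentCoord_eq_zero hφ h₃,
    div_eq_one_iff_eq Real.goldenRatio_ne_zero]
  rw [sub_zero, neg_div, one_div, Real.inv_goldenRatio, neg_neg]
  exact Real.one_sub_goldenRatio

/-! ### Parameters with prescribed critical value -/

/-- The family `(s, x) ↦ (s, F_s x)` of all the maps `F_s` with `s > 0`. -/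
noncomputable def cubicFamily (z : Set.Ioi (0 : ℝ) × ℝ) : Set.Ioi (0 : ℝ) × ℝ :=
  (z.1, cubicMap z.1 z.2)

/-- The tent coordinate of `F_s` for slope the golden ratio. -/
noncomputable def cubicTent (s x : ℝ) : ℝ := tentCoord Real.goldenRatio (cubicMap s) id x

theorem continuousOn_cubicA : ContinuousOn cubicA (Set.Ioi 0) :=
  continuousOn_const.add <| continuousOn_const.div (by fun_prop) fun s (hs : 0 < s) => by positivity

theorem continuousOn_cubicB : ContinuousOn cubicB (Set.Ioi 0) :=
  continuousOn_id.neg.sub <| continuousOn_const.div (by fun_prop) fun s (hs : 0 < s) => by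
    positivity

theorem continuous_cubicFamily : Continuous cubicFamily := by
  have hA : Continuous fun z : Set.Ioi (0 : ℝ) × ℝ => cubicA z.1 :=
    continuousOn_cubicA.domRestrict.comp continuous_fst
  have hB : Continuous fun z : Set.Ioi (0 : ℝ) × ℝ => cubicB z.1 :=
    continuousOn_cubicB.domRestrict.comp continuous_fst
  refine continuous_fst.prodMk ?_
  simp only [cubicMap_apply]
  fun_prop

theorem tentCoord_cubicFamily (z : Set.Ioi (0 : ℝ) × ℝ) :
    tentCoord Real.goldenRatio cubicFamily Prod.snd z = cubicTent z.1 z.2 :=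
  (tentCoord_semiconj (e := Prod.mk z.1) (fun _ => rfl) z.2).symm

theorem cubicTent_zero (s : ℝ) : cubicTent s 0 = 0 :=
  tentCoord_eq_zero Real.one_lt_goldenRatio rfl

theorem cubicTent_of_neg {s x : ℝ} (hx : x < 0) :
    cubicTent s x = Real.goldenConj * (1 - cubicTent s (cubicMap s x)) := by
  rw [cubicTent, tentCoord_of_neg Real.one_lt_goldenRatio hx, ← cubicTent, neg_div, div_eq_inv_mul,
    Real.inv_goldenRatio]
  ring

theorem cubicTent_neg {s : ℝ} (hs : 0 < s) : cubicTent s (-s) = Real.goldenConj := by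
  rw [cubicTent_of_neg (neg_lt_zero.2 hs), cubicMap_neg hs, cubicTent_zero, sub_zero, mul_one]

theorem cubicTent_one {s : ℝ} (hs : 0 < s) : cubicTent s 1 = 1 := by
  suffices tentCoord Real.goldenRatio (cubicMap s) id (cubicMap s 0) = 1 by
    rwa [cubicMap_zero] at this
  refine tentCoord_goldenRatio_map_eq_one ?_ ?_ ?_ <;>
    simp [cubicMap_zero, cubicMap_one, cubicMap_neg hs, hs]

theorem continuous_tentCoord_cubicFamily :
    Continuous (tentCoord Real.goldenRatio cubicFamily Prod.snd) := by
  refine continuous_tentCoord Real.one_lt_goldenRatio continuous_cubicFamily continuous_snd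
    fun z hz => ?_
  rw [tentCoord_cubicFamily, cubicFamily, hz, cubicMap_zero, cubicTent_one z.1.2]

theorem exists_cubicCrit_eq_neg :
    ∃ t, 1 < t ∧ cubicCrit t = -t ∧ ∀ s ∈ Set.Icc 1 t, IsGoldenParam s := by
  obtain ⟨t, ht, h0⟩ := intermediate_value_Ioo (show (1 : ℝ) ≤ 3 / 2 by norm_num)
    (f := fun t => t ^ 3 * (t + 1) - (2 + 3 * t)) (by fun_prop)
    (show (0 : ℝ) ∈ _ from ⟨by norm_num, by norm_num⟩)
  simp only at h0
  refine ⟨t, ht.1, ?_, fun s hs => ⟨hs.1, cubicCrit_le_neg hs.1 ?_⟩⟩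
  · rw [eq_neg_iff_add_eq_zero, cubicCrit_add_self ht.1.le, h0, zero_div]
  · have hquot : 0 ≤ (t - s) * ((t ^ 2 + s ^ 2) * (t + s) + (t ^ 2 + t * s + s ^ 2) - 3) := by
      refine mul_nonneg (sub_nonneg.2 hs.2) ?_
      nlinarith [hs.1, ht.1, one_le_pow₀ hs.1 (n := 2), one_le_pow₀ ht.1.le (n := 2)]
    linear_combination hquot + h0

theorem cubicTent_cubicCrit_one : cubicTent 1 (cubicCrit 1) = -1 := by
  have hcrit : cubicCrit 1 = -2 := by norm_num [cubicCrit, cubicA, cubicB]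
  have hmap : cubicMap 1 (-2) = -1 := by norm_num [cubicMap_apply, cubicA, cubicB]
  rw [hcrit, cubicTent_of_neg (by norm_num), hmap, cubicTent_neg one_pos]
  linear_combination -Real.goldenConj_sq

theorem surjOn_cubicTent_cubicCrit {t : ℝ} (ht : 1 ≤ t) (hcrit : cubicCrit t = -t) :
    Set.SurjOn (fun s => cubicTent s (cubicCrit s)) (Set.Icc 1 t)
      (Set.Icc (-1) Real.goldenConj) := by
  have hcont : ContinuousOn (fun s => cubicTent s (cubicCrit s)) (Set.Icc 1 t) := by
    have hpos : ∀ s : Set.Icc 1 t, 0 < s.1 := fun s => one_pos.trans_le s.2.1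
    have hA := continuousOn_cubicA.comp_continuous continuous_subtype_val hpos
    have hB := continuousOn_cubicB.comp_continuous continuous_subtype_val hpos
    have hC : Continuous fun s : Set.Icc 1 t => cubicCrit s :=
      (hB.const_mul _).div (hA.const_mul _) fun s => mul_ne_zero three_ne_zero (cubicA_neg s.2.1).ne
    rw [continuousOn_iff_continuous_domRestrict]
    exact (continuous_tentCoord_cubicFamily.comp
      (Continuous.prodMk (continuous_subtype_val.subtype_mk hpos) hC)).congr fun s =>
        tentCoord_cubicFamily _
  have hivt := intermediate_value_Icc ht hcont
  rwa [cubicTent_cubicCrit_one, hcrit, cubicTent_neg (by linarith)] at hivt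

/-! ### Critical orbits -/

theorem derivative_cubicF {s : ℝ} (hs : 1 ≤ s) :
    (cubicF s).derivative = C (3 * cubicA s) * (X * (X - C (cubicCrit s))) := by
  refine Polynomial.funext fun x => ?_
  have hderiv : deriv (cubicMap s) x = _ := (cubicF s).deriv
  rw [← hderiv, cubicMap_eq_cubicWithCrit hs, (hasDerivAt_cubicWithCrit x).deriv]
  simp

theorem cubicCrit_mem_critSet {s : ℝ} (hs : 1 ≤ s) : cubicCrit s ∈ critSet (cubicF s) := by
  simp [critSet, derivative_cubicF hs]

theorem setOf_aeval_derivative_cubicF_eq_zero {s : ℝ} (hs : 1 ≤ s) :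
    {z : ℂ | aeval z (cubicF s).derivative = 0} = {((0 : ℝ) : ℂ), (cubicCrit s : ℂ)} := by
  ext z
  simp [derivative_cubicF hs, (cubicA_neg hs).ne, sub_eq_zero]

theorem natDegree_cubicF {s : ℝ} (hs : 1 ≤ s) : (cubicF s).natDegree = 3 := by
  have := (cubicA_neg hs).ne
  unfold cubicF
  compute_degree!

namespace IsGoldenParam

variable {s : ℝ}

theorem iterate_cubicCrit_mem (h : IsGoldenParam s) (k : ℕ) :
    (cubicMap s)^[k + 1] (cubicCrit s) ∈ Set.Icc (-s) 1 := by
  have hc : cubicCrit s < 0 := by linarith [h.crit_le, h.pos]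
  refine h.isGoldenUnimodal.mapsTo_Icc.iterate k ⟨h.neg_le_cubicMap hc.le, ?_⟩
  by_contra hlt
  linarith [h.lt_of_one_lt_cubicMap (not_le.1 hlt)]

theorem not_tendsto_abs_iterate_cubicCrit (h : IsGoldenParam s) :
    ¬ Tendsto (fun k : ℕ => |(cubicMap s)^[k] (cubicCrit s)|) atTop atTop := by
  intro hlim
  obtain ⟨k, hk⟩ := ((hlim.comp (tendsto_add_atTop_nat 1)).eventually_gt_atTop s).exists
  obtain ⟨hlo, hhi⟩ := h.iterate_cubicCrit_mem k
  exact hk.not_ge (abs_le.2 ⟨hlo, hhi.trans h.one_le⟩)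

theorem cubicTent_mem_subfield_of_tendsto (h : IsGoldenParam s) {K : Subfield ℝ}
    (hK : Real.goldenRatio ∈ K) {x₀ c : ℝ} {n m : ℕ} (hn : n ≠ 0)
    (hx₀ : Function.IsPeriodicPt (cubicMap s) n x₀)
    (hc : Tendsto (fun k : ℕ => (cubicMap s)^[k * n + m] c) atTop (𝓝 x₀)) : cubicTent s c ∈ K := by
  obtain ⟨i, j, hij, heq⟩ := exists_tentCoord_iterate_eq_of_tendsto (g := id)
    Real.one_lt_goldenRatio h.isGoldenUnimodal.continuous continuous_id (fun x (hx : x = 0) => by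
      rw [hx, cubicMap_zero, ← cubicTent, cubicTent_one h.pos]) hn hx₀ hc
  exact tentCoord_mem_subfield Real.one_lt_goldenRatio hK hij heq

theorem not_isPCF (h : IsGoldenParam s) {K : Subfield ℝ} (hK : Real.goldenRatio ∈ K)
    (hcrit : cubicTent s (cubicCrit s) ∉ K) : ¬ IsPCF (cubicF s) := by
  intro hpcf
  have hinj : Function.Injective fun k => (cubicMap s)^[k] (cubicCrit s) :=
    Function.Injective.of_lt_imp_ne fun i j hij heq => hcrit <|
      tentCoord_mem_subfield Real.one_lt_goldenRatio hK hij (congrArg _ heq)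
  exact Set.infinite_range_of_injective hinj
    (hpcf.subset (Set.subset_biUnion_of_mem (u := fun c => Set.range fun k : ℕ =>
      (fun x => (cubicF s).eval x)^[k] c) (cubicCrit_mem_critSet h.one_le)))

theorem not_isHyperbolicPoly (h : IsGoldenParam s) {K : Subfield ℝ} (hK : Real.goldenRatio ∈ K)
    (hcrit : cubicTent s (cubicCrit s) ∉ K) : ¬ IsHyperbolicPoly (cubicF s) := by
  intro hhyp
  rcases hhyp _ (cubicCrit_mem_critSet h.one_le) with ⟨n, x₀, ⟨hn, hx₀, -⟩, m, hlim⟩ | hlim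
  · exact hcrit (h.cubicTent_mem_subfield_of_tendsto hK (by omega) hx₀ hlim)
  · exact h.not_tendsto_abs_iterate_cubicCrit hlim

end IsGoldenParam

theorem not_countable_not_isPCF_not_isHyperbolicPoly {t : ℝ} (ht : 1 ≤ t)
    (hcrit : cubicCrit t = -t) (hparam : ∀ s ∈ Set.Icc 1 t, IsGoldenParam s) :
    ¬ {s : ℝ | s ∈ Set.Icc 1 t ∧ ¬ IsPCF (cubicF s) ∧ ¬ IsHyperbolicPoly (cubicF s)}.Countable := by
  intro hcount
  have hK : (Subfield.closure {Real.goldenRatio} : Set ℝ).Countable := by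
    rw [← Cardinal.le_aleph0_iff_set_countable]
    exact (Subfield.cardinalMk_closure_le_max _).trans (by simp)
  have hcover : Set.Icc (-1) Real.goldenConj ⊆ Subfield.closure {Real.goldenRatio} ∪
      (fun s => cubicTent s (cubicCrit s)) ''
        {s : ℝ | s ∈ Set.Icc 1 t ∧ ¬ IsPCF (cubicF s) ∧ ¬ IsHyperbolicPoly (cubicF s)} := by
    intro v hv
    obtain ⟨s, hs, rfl⟩ := surjOn_cubicTent_cubicCrit ht hcrit hv
    refine or_iff_not_imp_left.2 fun hsK => ⟨s, ⟨hs, ?_, ?_⟩, rfl⟩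
    · exact (hparam s hs).not_isPCF (Subfield.subset_closure (Set.mem_singleton _)) hsK
    · exact (hparam s hs).not_isHyperbolicPoly (Subfield.subset_closure (Set.mem_singleton _)) hsK
  have hIcc : (Set.Icc (-1) Real.goldenConj).Countable :=
    (hK.union (hcount.image _)).mono hcover
  rw [← Cardinal.le_aleph0_iff_set_countable, Cardinal.mk_Icc_real Real.neg_one_lt_goldenConj]
    at hIcc
  exact hIcc.not_gt Cardinal.aleph0_lt_continuum

theorem mainTheorem5 :
    ∃ sStar : ℝ, 1 < sStar ∧
      (∀ s ∈ Set.Icc 1 sStar,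
        -- `F_s` is cubic, and its complex critical points are two distinct real numbers
        (cubicF s).natDegree = 3 ∧
        (∃ c₁ c₂ : ℝ, c₁ ≠ c₂ ∧
          {z : ℂ | aeval z (cubicF s).derivative = 0} = {(c₁ : ℂ), (c₂ : ℂ)}) ∧
        -- the zeta function of the map `F_s : ℝ → ℝ` is defined, and has the stated value
        (∀ n : ℕ, 1 ≤ n → {x : ℝ | (fun y => (cubicF s).eval y)^[n] x = x}.Finite) ∧
        artinMazurZeta (fun x : ℝ => (cubicF s).eval x) =
          ((1 - PowerSeries.X ^ 3) * (1 - PowerSeries.X ^ 2) *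
            (1 - PowerSeries.X - PowerSeries.X ^ 2))⁻¹) ∧
      ¬ {s : ℝ | s ∈ Set.Icc 1 sStar ∧ ¬ IsPCF (cubicF s) ∧
          ¬ IsHyperbolicPoly (cubicF s)}.Countable := by
  obtain ⟨t, ht, hcrit, hparam⟩ := exists_cubicCrit_eq_neg
  refine ⟨t, ht, fun s hs => ?_, not_countable_not_isPCF_not_isHyperbolicPoly ht.le hcrit hparam⟩
  have h := hparam s hs
  exact ⟨natDegree_cubicF hs.1, ⟨0, cubicCrit s, by linarith [h.crit_le, h.pos],
    setOf_aeval_derivative_cubicF_eq_zero hs.1⟩,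
    fun n hn => h.finite_ptsOfPeriod (by omega), h.artinMazurZeta_cubicMap⟩
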